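/- Let $\mathbb K$ be a field of characteristic $0$; degrees are homological (differentials have degree $-1$) and the Koszul sign rule is used throughout. Let $E$ be a dg $\mathbb S$-module concentrated in arity $2$, let $R$ be a dg $\mathbb S$-submodule of the part $\mathcal F(E)^{(2)}$ of weight $2$ of the free operad $\mathcal F(E)$ (trees with two vertices), and let $\mathcal P=\mathcal F(E)/(R)$ be the corresponding quadratic binary operad. Let $\mathcal P^{\text{!`}}$ be its Koszul dual cooperad, that is, the subcooperad of the cofree cooperad $\mathcal F^c(sE)$ which is the kernel of the part $d_2$ (composition of two adjacent vertices in $\mathcal P$) of the differential of the bar construction of $\mathcal P$, and let $\kappa:\mathcal P^{\text{!`}}\to\mathcal P$ be the map of degree $-1$ given by $sE\xrightarrow{s^{-1}}E$ on the cogenerators and zero on the other weights. Let $A$ be a dg $\mathcal P$-algebra, let $M$ be a dg $A$-module over $\mathcal P$, and let $C$ be a dg $\mathcal P^{\text{!`}}$-coalgebra with structure map $\Delta_C:C\to\bigoplus_n(\mathcal P^{\text{!`}}(n)\otimes C^{\otimes n})^{\mathbb S_n}$. Let $\mathrm{Hom}(C,A)_p$ be the space of linear maps $C\to A$ of degree $p$,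 put $\partial f=d\circ f-(-1)^{|f|}f\circ d$, and define in the same way $(\mathrm{Hom}(C,M),\partial)$. For homogeneous $\varphi:C\to A$ and $g:C\to M$ let $$\kappa[\varphi,g]:=\sum_{n\ge1}\Big(C\xrightarrow{\Delta_C}(\mathcal P^{\text{!`}}(n)\otimes C^{\otimes n})^{\mathbb S_n}\xrightarrow{\kappa\otimes\varphi^{\otimes (n-1)}\otimes g}\mathcal P(n)\otimes A^{\otimes (n-1)}\otimes M\longrightarrow M\Big)$$ (only $n=2$ contributes), and define $\kappa[\varphi,\psi]$ for $\varphi,\psi:C\to A$ in the same way with $A$ in place of $M$. (1) $(\mathrm{Hom}(C,A),\kappa[-,-],\partial)$ is a dg Lie algebra with bracket of degree $-1$. Precisely, the shifted graded space $L_p:=\mathrm{Hom}(C,A)_{p+1}$, with the differential $\partial$ and the bracket $\{\varphi,\psi\}:=(-1)^{|\varphi|-1}\kappa[\varphi,\psi]$, is a dg Lie algebra: the bracket is bilinear of degree $0$ on $L$, $\partial$ is a differential of degree $-1$ and, with $\bar\varphi:=|\varphi|-1$, $$\{\varphi,\psi\}=-(-1)^{\bar\varphi\bar\psi}\{\psi,\varphi\},\qquad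 \{\varphi,\{\psi,\chi\}\}=\{\{\varphi,\psi\},\chi\}+(-1)^{\bar\varphi\bar\psi}\{\psi,\{\varphi,\chi\}\},\qquad \partial\{\varphi,\psi\}=\{\partial\varphi,\psi\}+(-1)^{\bar\varphi}\{\varphi,\partial\psi\}.$$ (2) For every $A$-module $M$, the complex $(\mathrm{Hom}(C,M),\partial)$ is a dg Lie module over the dg Lie algebra $L$ of (1), with the action $\varphi\cdot g:=(-1)^{|\varphi|-1}\kappa[\varphi,g]$: it is bilinear of degree $0$ on $L\otimes\mathrm{Hom}(C,M)$ and $$\varphi\cdot(\psi\cdot g)=\{\varphi,\psi\}\cdot g+(-1)^{\bar\varphi\bar\psi}\,\psi\cdot(\varphi\cdot g),\qquad \partial(\varphi\cdot g)=(\partial\varphi)\cdot g+(-1)^{\bar\varphi}\,\varphi\cdot(\partial g).$$ -/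

import Mathlib

open scoped TensorProduct DirectSum

universe u v w w' w''

namespace OperadLie

/-! ## Differential graded vector spaces and the Koszul sign rule -/

/-- A chain complex of `K`-vector spaces, as a vector space with a `ℤ`-grading and a
differential `d` of degree `-1`. -/
structure DGModule (K : Type u) [Field K] where
  carrier : Type v
  [grp : AddCommGroup carrier]
  [mod : Module K carrier]
  gr : ℤ → Submodule K carrier
  internal : DirectSum.IsInternal gr
  d : carrier →ₗ[K] carrier
  d_mem : ∀ (p : ℤ) (x : carrier), x ∈ gr p → d x ∈ gr (p - 1)
  d_d : ∀ x : carrier, d (d x) = 0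

instance (K : Type u) [Field K] : CoeSort (DGModule.{u, v} K) (Type v) := ⟨DGModule.carrier⟩

attribute [instance] DGModule.grp DGModule.mod

noncomputable section

variable {K : Type u} [Field K]

namespace DGModule

theorem bijective (V : DGModule.{u, v} K) :
    Function.Bijective (DirectSum.coeLinearMap V.gr) := V.internal

/-- The sign operator: `x ↦ (-1)^|x| x`. -/
def eps (V : DGModule.{u, v} K) : V →ₗ[K] V :=
  (DirectSum.toModule K ℤ V fun p => ((-1 : K) ^ p) • (V.gr p).subtype) ∘ₗ
    (LinearEquiv.ofBijective (DirectSum.coeLinearMap V.gr) V.bijective).symm.toLinearMap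

theorem eps_apply (V : DGModule.{u, v} K) {p : ℤ} {x : V} (hx : x ∈ V.gr p) :
    V.eps x = ((-1 : K) ^ p) • x := by
  have h : (LinearEquiv.ofBijective (DirectSum.coeLinearMap V.gr) V.bijective).symm x
      = DirectSum.lof K ℤ (fun p => V.gr p) p ⟨x, hx⟩ := by
    rw [LinearEquiv.symm_apply_eq]
    simp
  simp [eps, h]

/-- `x ↦ (-1)^(n |x|) x`. -/
def epsPow (V : DGModule.{u, v} K) (n : ℤ) : V →ₗ[K] V :=
  if Even n then LinearMap.id else V.eps

/-- The projection onto the sum of the components of even degree (for `false`), respectively of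
odd degree (for `true`), in characteristic different from `2`. -/
def parity (V : DGModule.{u, v} K) (b : Bool) : V →ₗ[K] V :=
  (2⁻¹ : K) • (if b then LinearMap.id - V.eps else LinearMap.id + V.eps)

/-- The sign operator on a tensor power. -/
def tensEps (V : DGModule.{u, v} K) (n : ℕ) : (⨂[K]^n V) →ₗ[K] (⨂[K]^n V) :=
  PiTensorProduct.map fun _ => V.eps

/-- The sign of the permutation which `σ` induces on those factors that are odd according
to `q`. -/
def koszulSign {n : ℕ} (σ : Equiv.Perm (Fin n)) (q : Fin n → Bool) : K :=
  ∏ i : Fin n, ∏ j : Fin n, if i < j ∧ σ j < σ i ∧ q i = true ∧ q j = true then -1 else 1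

/-- The action of the symmetric group on a tensor power, with Koszul signs: the factor in
place `i` is moved to place `σ i`. -/
def koszul (V : DGModule.{u, v} K) {n : ℕ} (σ : Equiv.Perm (Fin n)) :
    (⨂[K]^n V) →ₗ[K] (⨂[K]^n V) :=
  ∑ q : Fin n → Bool, koszulSign (K := K) σ q •
    ((PiTensorProduct.reindex K (fun _ : Fin n => (V : Type v)) σ).toLinearMap ∘ₗ
      PiTensorProduct.map fun i => V.parity (q i))

/-- The differential of a tensor power:
`∑ i, (-1)^(|x₀| + ⋯ + |xᵢ₋₁|) x₀ ⊗ ⋯ ⊗ d xᵢ ⊗ ⋯`. -/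
def tensD (V : DGModule.{u, v} K) (n : ℕ) : (⨂[K]^n V) →ₗ[K] (⨂[K]^n V) :=
  ∑ i : Fin n, PiTensorProduct.map fun j =>
    if j < i then V.eps else if j = i then V.d else LinearMap.id

/-- The component of degree `p` of a tensor power. -/
def tensGr (V : DGModule.{u, v} K) (n : ℕ) (p : ℤ) : Submodule K (⨂[K]^n V) :=
  Submodule.span K {x | ∃ (r : Fin n → ℤ) (y : Fin n → V),
    (∀ i, y i ∈ V.gr (r i)) ∧ ∑ i, r i = p ∧ x = PiTensorProduct.tprod K y}

/-- The suspension: `(sV)_p = V_{p-1}`, with `d (s x) = - s (d x)`. The underlying vector spaces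
of `sV` and `V` are the same and `x ↦ s x` is the identity. -/
abbrev susp (V : DGModule.{u, v} K) : DGModule.{u, v} K where
  carrier := V
  gr p := V.gr (p - 1)
  internal := by
    rw [DirectSum.isInternal_submodule_iff_iSupIndep_and_iSup_eq_top]
    have h := (DirectSum.isInternal_submodule_iff_iSupIndep_and_iSup_eq_top V.gr).1 V.internal
    refine ⟨h.1.comp (sub_left_injective (b := (1 : ℤ))), ?_⟩
    rw [← h.2]
    exact (Equiv.subRight (1 : ℤ)).iSup_comp (g := V.gr)
  d := -V.d
  d_mem p x hx := by
    simpa using V.d_mem (p - 1) x hx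
  d_d x := by simp [V.d_d]

/-- The homogeneous maps of degree `p` between graded vector spaces. -/
def hom (V : DGModule.{u, v} K) (W : DGModule.{u, w} K) (p : ℤ) : Submodule K (V →ₗ[K] W) where
  carrier := {f | ∀ (i : ℤ) (x : V), x ∈ V.gr i → f x ∈ W.gr (i + p)}
  add_mem' hf hg i x hx := (W.gr _).add_mem (hf i x hx) (hg i x hx)
  zero_mem' _ _ _ := (W.gr _).zero_mem
  smul_mem' c _ hf i x hx := (W.gr _).smul_mem c (hf i x hx)

/-- The differential of the complex of homogeneous maps on maps of degree `p`:
`∂ f = d ∘ f - (-1)^p f ∘ d`. -/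
def homD (V : DGModule.{u, v} K) (W : DGModule.{u, w} K) (p : ℤ) (f : V →ₗ[K] W) : V →ₗ[K] W :=
  W.d ∘ₗ f - ((-1 : K) ^ p) • (f ∘ₗ V.d)

end DGModule

/-! ## Places in tensor powers -/

/-- The place, among `k + l + 1` inputs, of the input `j ≠ i` of an operation with `k + 1`
inputs, after an operation with `l + 1` inputs has been plugged into the input `i`. -/
def outerPlace {k : ℕ} (l : ℕ) (i j : Fin (k + 1)) : Fin (k + l + 1) :=
  if j < i then ⟨j, by omega⟩ else ⟨j + l, by omega⟩

/-- The place, among `k + l + 1` inputs, of the input `q` of an operation with `l + 1` inputs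
which has been plugged into the input `i` of an operation with `k + 1` inputs. -/
def innerPlace {k l : ℕ} (i : Fin (k + 1)) (q : Fin (l + 1)) : Fin (k + l + 1) :=
  ⟨i + q, by omega⟩

/-- The inputs of a composite `μ ∘ᵢ ν` are the inputs `j ≠ i` of `μ` and the inputs of `ν`. -/
def placeEquiv {k : ℕ} (l : ℕ) (i : Fin (k + 1)) :
    {j : Fin (k + 1) // j ≠ i} ⊕ Fin (l + 1) ≃ Fin (k + l + 1) :=
  Equiv.ofBijective (Sum.elim (fun j => outerPlace l i j.1) (innerPlace i)) (by
    constructor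
    · rintro (⟨a, ha⟩ | a) (⟨b, hb⟩ | b) h
      all_goals
        simp only [Sum.elim_inl, Sum.elim_inr, outerPlace, innerPlace, Fin.lt_def] at h
        simp only [ne_eq, Fin.ext_iff] at *
      · simp only [Sum.inl.injEq, Subtype.mk.injEq, Fin.ext_iff]
        split_ifs at h <;> simp at h <;> omega
      · exfalso
        have := b.2
        split_ifs at h <;> simp at h <;> omega
      · exfalso
        have := a.2
        split_ifs at h <;> simp at h <;> omega
      · simp only [Sum.inr.injEq, Fin.ext_iff]
        omega
    · intro x
      have hx := x.2
      have hi := i.2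
      by_cases h1 : (x : ℕ) < i
      · refine ⟨Sum.inl ⟨⟨x, by omega⟩, ?_⟩, ?_⟩
        · simp only [ne_eq, Fin.ext_iff]; omega
        · simp only [Sum.elim_inl, outerPlace, Fin.lt_def, h1, if_true]
      · by_cases h2 : (x : ℕ) ≤ i + l
        · refine ⟨Sum.inr ⟨x - i, by omega⟩, ?_⟩
          simp only [Sum.elim_inr, innerPlace, Fin.ext_iff]
          omega
        · refine ⟨Sum.inl ⟨⟨x - l, by omega⟩, ?_⟩, ?_⟩
          · simp only [ne_eq, Fin.ext_iff]; omega
          · have h3 : ¬ ((x : ℕ) - l < i) := by omega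
            simp only [Sum.elim_inl, outerPlace, Fin.lt_def, h3, if_false, Fin.ext_iff]
            omega)

/-- The inputs `j ≠ i` together with the input `i`. -/
def pointEquiv {k : ℕ} (i : Fin (k + 1)) :
    {j : Fin (k + 1) // j ≠ i} ⊕ Unit ≃ Fin (k + 1) :=
  Equiv.ofBijective (Sum.elim Subtype.val fun _ => i) (by
    constructor
    · rintro (⟨a, ha⟩ | a) (⟨b, hb⟩ | b) h
      · simpa using h
      · exact absurd h ha
      · exact absurd h.symm hb
      · rfl
    · intro x
      by_cases h : x = i
      · exact ⟨Sum.inr (), h.symm⟩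
      · exact ⟨Sum.inl ⟨x, h⟩, rfl⟩)

section Split

variable (K) (V : Type v) [AddCommGroup V] [Module K V]

/-- Separate the factor in place `i` of a tensor power from the other factors (which keep their
order). -/
def split {k : ℕ} (i : Fin (k + 1)) :
    (⨂[K]^(k + 1) V) ≃ₗ[K] (⨂[K] _ : {j : Fin (k + 1) // j ≠ i}, V) ⊗[K] V :=
  (PiTensorProduct.reindex K (fun _ : Fin (k + 1) => V) (pointEquiv i).symm).trans
    ((PiTensorProduct.tmulEquiv K V).symm.trans
      (TensorProduct.congr (LinearEquiv.refl K _)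
        (PiTensorProduct.subsingletonEquiv (R := K) (s := fun _ : Unit => V) ())))

/-- Insert `l + 1` factors in place of the missing factor `i`. -/
def merge {k : ℕ} (l : ℕ) (i : Fin (k + 1)) :
    (⨂[K] _ : {j : Fin (k + 1) // j ≠ i}, V) ⊗[K] (⨂[K]^(l + 1) V) ≃ₗ[K]
      (⨂[K]^(k + l + 1) V) :=
  (PiTensorProduct.tmulEquiv K V).trans
    (PiTensorProduct.reindex K
      (fun _ : {j : Fin (k + 1) // j ≠ i} ⊕ Fin (l + 1) => V) (placeEquiv l i))

end Split

/-! ## Binary trees -/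

/-- Planar binary rooted trees whose leaves are labelled by `X` and whose vertices are labelled
by `Y`. -/
inductive BTree (X Y : Type) : Type
  | leaf (x : X) : BTree X Y
  | node (y : Y) (l r : BTree X Y) : BTree X Y

namespace BTree

variable {X Y X' Y' : Type}

def leaves : BTree X Y → List X
  | leaf x => [x]
  | node _ l r => l.leaves ++ r.leaves

def verts : BTree X Y → List Y
  | leaf _ => []
  | node y l r => y :: (l.verts ++ r.verts)

/-- Relabel the vertices by `g` and replace the leaf `x` by the tree `f x`. -/
def subst (f : X → BTree X' Y') (g : Y → Y') : BTree X Y → BTree X' Y'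
  | leaf x => f x
  | node y l r => node (g y) (l.subst f g) (r.subst f g)

/-- Relabel the leaves by `f` and the vertices by `g`. -/
def relabel (f : X → X') (g : Y → Y') : BTree X Y → BTree X' Y' :=
  subst (fun x => leaf (f x)) g

/-- Exchange the two subtrees above the vertex labelled `y`. -/
def swapAt [DecidableEq Y] (y : Y) : BTree X Y → BTree X Y
  | leaf x => leaf x
  | node z l r => if z = y then node z r l else node z (l.swapAt y) (r.swapAt y)

/-- Every leaf label and every vertex label is used exactly once. -/
def Valid (t : BTree X Y) : Prop :=
  (t.leaves.Nodup ∧ ∀ x, x ∈ t.leaves) ∧ (t.verts.Nodup ∧ ∀ y, y ∈ t.verts)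

theorem leaves_subst (f : X → BTree X' Y') (g : Y → Y') (t : BTree X Y) :
    (t.subst f g).leaves = t.leaves.flatMap fun x => (f x).leaves := by
  induction t with
  | leaf x => simp [subst, leaves]
  | node y l r hl hr => simp [subst, leaves, hl, hr]

theorem verts_subst_perm (f : X → BTree X' Y') (g : Y → Y') (t : BTree X Y) :
    (t.subst f g).verts.Perm (t.verts.map g ++ t.leaves.flatMap fun x => (f x).verts) := by
  induction t with
  | leaf x => simp [subst, verts, leaves]
  | node y l r hl hr =>
    simp only [subst, verts, leaves, List.map_cons, List.map_append, List.flatMap_append,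
      List.cons_append, List.perm_cons]
    refine (hl.append hr).trans ?_
    rw [List.append_assoc, List.append_assoc]
    refine List.Perm.append_left _ ?_
    rw [← List.append_assoc, ← List.append_assoc]
    exact List.Perm.append_right _ List.perm_append_comm

theorem valid_relabel {t : BTree X Y} (ht : t.Valid) (f : X ≃ X') (g : Y ≃ Y') :
    (t.relabel f g).Valid := by
  have h1 : (t.relabel f g).leaves = t.leaves.map f := by
    rw [relabel, leaves_subst, List.map_eq_flatMap]
    rfl
  have h2 : (t.relabel f g).verts.Perm (t.verts.map g) := by
    have h := verts_subst_perm (fun x => (leaf (f x) : BTree X' Y')) g t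
    have h0 : (t.leaves.flatMap fun x => (leaf (f x) : BTree X' Y').verts) = [] := by
      simp [verts]
    rwa [h0, List.append_nil] at h
  refine ⟨⟨?_, fun x => ?_⟩, ⟨?_, fun y => ?_⟩⟩
  · rw [h1]; exact ht.1.1.map f.injective
  · rw [h1, List.mem_map]; exact ⟨f.symm x, ht.1.2 _, by simp⟩
  · rw [h2.nodup_iff]; exact ht.2.1.map g.injective
  · rw [h2.mem_iff, List.mem_map]; exact ⟨g.symm y, ht.2.2 _, by simp⟩

/-- Graft `s` on the leaf `i` of `t`. The inputs are numbered as in `placeEquiv` and the vertices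
of `s` come after those of `t`. -/
def graft {k l : ℕ} (t : BTree (Fin (k + 1)) (Fin k)) (i : Fin (k + 1))
    (s : BTree (Fin (l + 1)) (Fin l)) : BTree (Fin (k + l + 1)) (Fin (k + l)) :=
  t.subst
    (fun j => if h : j = i then s.relabel (fun q => placeEquiv l i (Sum.inr q)) (Fin.natAdd k)
      else leaf (placeEquiv l i (Sum.inl ⟨j, h⟩)))
    (Fin.castAdd l)

theorem valid_graft {k l : ℕ} {t : BTree (Fin (k + 1)) (Fin k)} (ht : t.Valid)
    (i : Fin (k + 1)) {s : BTree (Fin (l + 1)) (Fin l)} (hs : s.Valid) :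
    (graft t i s).Valid := by
  have key : ∀ {α β : Type} (L : List α) (F : α → List β), L.Nodup → (∀ a ∈ L, (F a).Nodup) →
      (∀ a ∈ L, ∀ b ∈ L, ∀ z, z ∈ F a → z ∈ F b → a = b) → (L.flatMap F).Nodup := by
    intro α β L F hL h1 h2
    rw [List.nodup_flatMap]
    refine ⟨h1, hL.imp_of_mem ?_⟩
    intro a b ha hb hab z hza hzb
    exact hab (h2 a ha b hb z hza hzb)
  set F : Fin (k + 1) → BTree (Fin (k + l + 1)) (Fin (k + l)) := fun j =>
    if h : j = i then s.relabel (fun q => placeEquiv l i (Sum.inr q)) (Fin.natAdd k)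
      else leaf (placeEquiv l i (Sum.inl ⟨j, h⟩)) with hF
  have hFi : F i = s.relabel (fun q => placeEquiv l i (Sum.inr q)) (Fin.natAdd k) := by
    simp [hF]
  have hFj : ∀ (j : Fin (k + 1)) (h : j ≠ i), F j = leaf (placeEquiv l i (Sum.inl ⟨j, h⟩)) := by
    intro j h
    simp [hF, h]
  have hLi : (F i).leaves = s.leaves.map fun q => placeEquiv l i (Sum.inr q) := by
    rw [hFi, relabel, leaves_subst, List.map_eq_flatMap]
    rfl
  have hVi : (F i).verts.Perm (s.verts.map (Fin.natAdd k)) := by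
    have h := verts_subst_perm (fun q => (leaf (placeEquiv l i (Sum.inr q)) :
      BTree (Fin (k + l + 1)) (Fin (k + l)))) (Fin.natAdd k) s
    have h0 : (s.leaves.flatMap fun q => (leaf (placeEquiv l i (Sum.inr q)) :
      BTree (Fin (k + l + 1)) (Fin (k + l))).verts) = [] := by
      simp [verts]
    rw [hFi]
    rwa [h0, List.append_nil] at h
  have hL : (graft t i s).leaves = t.leaves.flatMap fun j => (F j).leaves := leaves_subst _ _ _
  have hV : (graft t i s).verts.Perm
      (t.verts.map (Fin.castAdd l) ++ t.leaves.flatMap fun j => (F j).verts) :=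
    verts_subst_perm _ _ _
  have hmemL : ∀ j z, z ∈ (F j).leaves → (∃ h : j ≠ i, z = placeEquiv l i (Sum.inl ⟨j, h⟩)) ∨
      (j = i ∧ ∃ q, z = placeEquiv l i (Sum.inr q)) := by
    intro j z hz
    by_cases h : j = i
    · subst h
      rw [hLi, List.mem_map] at hz
      obtain ⟨q, -, hq⟩ := hz
      exact Or.inr ⟨rfl, q, hq.symm⟩
    · rw [hFj j h] at hz
      exact Or.inl ⟨h, by simpa [leaves] using hz⟩
  have hmemV : ∀ j z, z ∈ (F j).verts → j = i ∧ ∃ y, z = Fin.natAdd k y := by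
    intro j z hz
    by_cases h : j = i
    · subst h
      rw [hVi.mem_iff, List.mem_map] at hz
      obtain ⟨q, -, hq⟩ := hz
      exact ⟨rfl, q, hq.symm⟩
    · rw [hFj j h] at hz
      simp [verts] at hz
  refine ⟨⟨?_, ?_⟩, ⟨?_, ?_⟩⟩
  · rw [hL]
    refine key _ _ ht.1.1 ?_ ?_
    · intro j _
      by_cases h : j = i
      · subst h
        rw [hLi]
        refine hs.1.1.map ?_
        exact (placeEquiv l j).injective.comp Sum.inr_injective
      · rw [hFj j h]
        simp [leaves]
    · intro a _ b _ z hza hzb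
      rcases hmemL a z hza with ⟨ha, h1⟩ | ⟨ha, q, h1⟩ <;>
        rcases hmemL b z hzb with ⟨hb, h2⟩ | ⟨hb, q', h2⟩
      · have := (placeEquiv l i).injective (h1.symm.trans h2)
        simpa using this
      · have := (placeEquiv l i).injective (h1.symm.trans h2)
        simp at this
      · have := (placeEquiv l i).injective (h1.symm.trans h2)
        simp at this
      · exact ha.trans hb.symm
  · intro z
    rw [hL, List.mem_flatMap]
    obtain ⟨w, rfl⟩ := (placeEquiv l i).surjective z
    rcases w with ⟨j, hj⟩ | q
    · exact ⟨j, ht.1.2 j, by rw [hFj j hj]; simp [leaves]⟩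
    · refine ⟨i, ht.1.2 i, ?_⟩
      rw [hLi, List.mem_map]
      exact ⟨q, hs.1.2 q, rfl⟩
  · rw [hV.nodup_iff, List.nodup_append]
    refine ⟨ht.2.1.map (Fin.castAdd_injective k l), key _ _ ht.1.1 ?_ ?_, ?_⟩
    · intro j _
      by_cases h : j = i
      · subst h
        rw [hVi.nodup_iff]
        exact hs.2.1.map (Fin.natAdd_injective l k)
      · rw [hFj j h]
        simp [verts]
    · intro a _ b _ z hza hzb
      exact (hmemV a z hza).1.trans (hmemV b z hzb).1.symm
    · intro a ha b hb hab
      rw [List.mem_map] at ha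
      rw [List.mem_flatMap] at hb
      obtain ⟨y, -, rfl⟩ := ha
      obtain ⟨j, -, hb⟩ := hb
      obtain ⟨-, y', rfl⟩ := hmemV j b hb
      have h1 := y.2
      simp [Fin.ext_iff] at hab
      omega
  · intro z
    rw [hV.mem_iff, List.mem_append, List.mem_map, List.mem_flatMap]
    refine Fin.addCases (fun y => Or.inl ⟨y, ht.2.2 y, rfl⟩) (fun y => Or.inr ?_) z
    refine ⟨i, ht.1.2 i, ?_⟩
    rw [hVi.mem_iff, List.mem_map]
    exact ⟨y, hs.2.2 y, rfl⟩

end BTree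

/-- Planar binary trees with `k` vertices, labelled bijectively by `0, …, k - 1`, and `k + 1`
leaves, labelled bijectively by `0, …, k`. -/
def Tree (k : ℕ) : Type := {t : BTree (Fin (k + 1)) (Fin k) // t.Valid}

namespace Tree

/-- Relabel the leaves by `σ` and the vertices by `π`. -/
def relabel {k : ℕ} (σ : Equiv.Perm (Fin (k + 1))) (π : Equiv.Perm (Fin k)) (t : Tree k) :
    Tree k :=
  ⟨t.1.relabel σ π, BTree.valid_relabel t.2 σ π⟩

/-- Graft `s` on the leaf `i` of `t`. -/
def graft {k l : ℕ} (t : Tree k) (i : Fin (k + 1)) (s : Tree l) : Tree (k + l) :=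
  ⟨t.1.graft i s.1, BTree.valid_graft t.2 i s.2⟩

/-- The tree without vertices. -/
def one : Tree 0 :=
  ⟨.leaf 0, by
    refine ⟨⟨by simp [BTree.leaves], fun x => ?_⟩, ⟨by simp [BTree.verts], fun y => y.elim0⟩⟩
    have h : x = 0 := Fin.ext (by omega)
    simp [BTree.leaves, h]⟩

/-- The tree with one vertex, whose inputs are in the standard order. -/
def corolla : Tree 1 :=
  ⟨.node 0 (.leaf 0) (.leaf 1), by
    unfold BTree.Valid
    decide⟩

/-- The three trees with two vertices `((0 1) 2)`, `((1 2) 0)` and `((2 0) 1)`. The vertex at the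
root has the label `0`. -/
def comb (u : Fin 3) : Tree 2 :=
  ⟨.node 0 (.node 1 (.leaf u) (.leaf (u + 1))) (.leaf (u + 2)), by
    unfold BTree.Valid
    revert u
    decide⟩

end Tree

/-! ## Binary quadratic operads

The generators form a dg `𝕊`-module concentrated in arity `2`. The free operad on it vanishes in
arity `0`, and its component in arity `k + 1` is spanned by the binary trees with `k` vertices, so
that `k` is also the weight. Throughout, the number `k` stands for the arity `k + 1`. -/

/-- A dg `𝕊`-module concentrated in arity `2`: a chain complex with an action of `𝕊₂`. -/
structure Generators (K : Type u) [Field K] extends DGModule.{u, v} K where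
  swap : carrier →ₗ[K] carrier
  swap_mem : ∀ (p : ℤ) (x : carrier), x ∈ gr p → swap x ∈ gr p
  swap_d : ∀ x : carrier, swap (d x) = d (swap x)
  swap_swap : ∀ x : carrier, swap (swap x) = x

namespace Generators

/-- The suspended generators, with `swap (s x) = s (swap x)`. -/
abbrev susp (E : Generators.{u, v} K) : Generators.{u, v} K where
  toDGModule := E.toDGModule.susp
  swap := E.swap
  swap_mem p x hx := E.swap_mem (p - 1) x hx
  swap_d x := (map_neg E.swap (E.d x)).trans (congrArg Neg.neg (E.swap_d x))
  swap_swap := E.swap_swap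

/-- The map `s x ↦ x`, of degree `-1`. -/
def desusp (E : Generators.{u, v} K) : E.susp.toDGModule →ₗ[K] E.toDGModule where
  toFun x := x
  map_add' _ _ := rfl
  map_smul' _ _ := rfl

variable (E : Generators.{u, v} K)

/-- Let the generator of `𝕊₂` act on the factor in place `y` of a tensor power. -/
def swapFactor {k : ℕ} (y : Fin k) :
    (⨂[K]^k E.toDGModule) →ₗ[K] (⨂[K]^k E.toDGModule) :=
  PiTensorProduct.map fun j => if j = y then E.swap else LinearMap.id

/-- Formal sums of trees whose vertices are decorated by generators; the factor in place `y` of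
the tensor power decorates the vertex `y`. -/
abbrev Raw (k : ℕ) : Type (max u v) := Tree k →₀ (⨂[K]^k E.toDGModule)

/-- The action of the symmetric group by relabelling the leaves: the leaf `j` becomes `σ j`. -/
def rawPerm {k : ℕ} (σ : Equiv.Perm (Fin (k + 1))) : E.Raw k →ₗ[K] E.Raw k :=
  Finsupp.lmapDomain _ K (Tree.relabel σ 1)

/-- The differential induced by that of the generators. -/
def rawD (k : ℕ) : E.Raw k →ₗ[K] E.Raw k :=
  Finsupp.mapRange.linearMap (E.toDGModule.tensD k)

/-- The partial composition `∘ᵢ`, by grafting trees. -/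
def rawComp {k : ℕ} (l : ℕ) (i : Fin (k + 1)) : E.Raw k →ₗ[K] E.Raw l →ₗ[K] E.Raw (k + l) :=
  Finsupp.lsum K fun t => (Finsupp.lsum K fun s =>
    (((TensorProduct.mk K (⨂[K]^k E.toDGModule) (⨂[K]^l E.toDGModule)).compr₂
      ((Finsupp.lsingle (t.graft i s)).comp
        (TensorPower.mulEquiv (R := K) (M := E.toDGModule)).toLinearMap)).flip)).flip

/-- The component of degree `p`. -/
def rawGr (k : ℕ) (p : ℤ) : Submodule K (E.Raw k) :=
  ⨆ t : Tree k, (E.toDGModule.tensGr k p).map (Finsupp.lsingle t)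

/-- The operadic ideal which identifies decorated trees that differ by the labels of the vertices
(with Koszul signs) or by the planar structure, and contains a set `S` of elements of weight `2`.
Without `S`, the quotient is the free operad. -/
inductive InIdeal (S : Set (E.Raw 2)) : ∀ k : ℕ, E.Raw k → Prop
  | zero (k : ℕ) : InIdeal S k 0
  | add (k : ℕ) (x y : E.Raw k) : InIdeal S k x → InIdeal S k y → InIdeal S k (x + y)
  | smul (k : ℕ) (c : K) (x : E.Raw k) : InIdeal S k x → InIdeal S k (c • x)
  | vertices (k : ℕ) (t : Tree k) (π : Equiv.Perm (Fin k)) (a : ⨂[K]^k E.toDGModule) :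
      InIdeal S k (Finsupp.single (t.relabel 1 π) (E.toDGModule.koszul π a) - Finsupp.single t a)
  | planar (k : ℕ) (t t' : Tree k) (y : Fin k) (h : t'.1 = t.1.swapAt y)
      (a : ⨂[K]^k E.toDGModule) :
      InIdeal S k (Finsupp.single t' (E.swapFactor y a) - Finsupp.single t a)
  | rel (x : E.Raw 2) : x ∈ S → InIdeal S 2 x
  | perm (k : ℕ) (σ : Equiv.Perm (Fin (k + 1))) (x : E.Raw k) :
      InIdeal S k x → InIdeal S k (E.rawPerm σ x)
  | diff (k : ℕ) (x : E.Raw k) : InIdeal S k x → InIdeal S k (E.rawD k x)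
  | comp_left (k l : ℕ) (i : Fin (k + 1)) (x : E.Raw k) (y : E.Raw l) :
      InIdeal S k x → InIdeal S (k + l) (E.rawComp l i x y)
  | comp_right (k l : ℕ) (i : Fin (k + 1)) (x : E.Raw k) (y : E.Raw l) :
      InIdeal S l y → InIdeal S (k + l) (E.rawComp l i x y)

/-- The component in weight `k` of the ideal, as a subspace. -/
def ideal (S : Set (E.Raw 2)) (k : ℕ) : Submodule K (E.Raw k) where
  carrier := {x | E.InIdeal S k x}
  add_mem' hx hy := InIdeal.add _ _ _ hx hy
  zero_mem' := InIdeal.zero _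
  smul_mem' c _ hx := InIdeal.smul _ c _ hx

/-- The quotient of the free operad by the operadic ideal generated by `S`, in arity `k + 1`. -/
abbrev Quo (S : Set (E.Raw 2)) (k : ℕ) : Type (max u v) := E.Raw k ⧸ E.ideal S k

variable (S : Set (E.Raw 2))

/-- The class of a decorated tree. -/
def tree {k : ℕ} (t : Tree k) : (⨂[K]^k E.toDGModule) →ₗ[K] E.Quo S k :=
  (E.ideal S k).mkQ ∘ₗ Finsupp.lsingle t

/-- The action of the symmetric group. -/
def perm {k : ℕ} (σ : Equiv.Perm (Fin (k + 1))) : E.Quo S k →ₗ[K] E.Quo S k :=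
  (E.ideal S k).mapQ (E.ideal S k) (E.rawPerm σ) fun x hx => InIdeal.perm k σ x hx

/-- The differential. -/
def diff (k : ℕ) : E.Quo S k →ₗ[K] E.Quo S k :=
  (E.ideal S k).mapQ (E.ideal S k) (E.rawD k) fun x hx => InIdeal.diff k x hx

/-- The component of degree `p`. -/
def grQ (k : ℕ) (p : ℤ) : Submodule K (E.Quo S k) :=
  (E.rawGr k p).map (E.ideal S k).mkQ

/-- The unit, in arity `1`. -/
def unit : E.Quo S 0 :=
  E.tree S Tree.one (PiTensorProduct.tprod K fun i => i.elim0)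

/-- The partial composition `∘ᵢ`. -/
def comp {k : ℕ} (l : ℕ) (i : Fin (k + 1)) :
    E.Quo S k →ₗ[K] E.Quo S l →ₗ[K] E.Quo S (k + l) :=
  ((E.ideal S l).liftQ
    ((E.ideal S k).liftQ ((E.rawComp l i).compr₂ (E.ideal S (k + l)).mkQ)
      (fun x hx => by
        rw [LinearMap.mem_ker]
        refine LinearMap.ext fun y => ?_
        rw [LinearMap.compr₂_apply, LinearMap.zero_apply, Submodule.mkQ_apply,
          Submodule.Quotient.mk_eq_zero]
        exact InIdeal.comp_left k l i x y hx)).flip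
    (fun y hy => by
      rw [LinearMap.mem_ker]
      refine LinearMap.ext fun x => ?_
      obtain ⟨x, rfl⟩ := Submodule.mkQ_surjective _ x
      rw [LinearMap.flip_apply, Submodule.mkQ_apply, Submodule.liftQ_apply,
        LinearMap.compr₂_apply, LinearMap.zero_apply, Submodule.mkQ_apply,
        Submodule.Quotient.mk_eq_zero]
      exact InIdeal.comp_right k l i x y hy)).flip

end Generators

/-- Quadratic data: a dg `𝕊`-module `E` of generators concentrated in arity `2` and a dg
`𝕊`-submodule `rel` of the component of weight `2` of the free operad on `E`, which lies in
arity `3`. -/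
structure QuadraticData (K : Type u) [Field K] where
  E : Generators.{u, v} K
  rel : Submodule K (E.Quo ∅ 2)
  rel_gr : rel ≤ ⨆ p : ℤ, rel ⊓ E.grQ ∅ 2 p
  rel_perm : ∀ (σ : Equiv.Perm (Fin 3)) (x : E.Quo ∅ 2), x ∈ rel → E.perm ∅ σ x ∈ rel
  rel_diff : ∀ x : E.Quo ∅ 2, x ∈ rel → E.diff ∅ 2 x ∈ rel

namespace QuadraticData

variable (X : QuadraticData.{u, v} K)

/-- The relations, as a set of formal sums of decorated trees. -/
def rels : Set (X.E.Raw 2) := {x | (X.E.ideal ∅ 2).mkQ x ∈ X.rel}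

/-- The component in arity `k + 1` of the binary quadratic operad presented by `X`, that is, of
the quotient of the free operad on `E` by the operadic ideal generated by `rel`. -/
abbrev Op (k : ℕ) : Type (max u v) := X.E.Quo X.rels k

/-! ### The Koszul dual cooperad

The bar construction of the operad `P` is bigraded by the number of vertices and by the total
weight. Its part with as many vertices as the total weight is the cofree cooperad on the suspended
generators; no part has more vertices, so the Koszul dual cooperad, being the homology of `d₂`
there, is the kernel of `d₂` on this cofree cooperad. -/

/-- The component in arity `k + 1` of the cofree cooperad on the suspended generators. An element
is a family of decorations, indexed by the trees, which is compatible with changes of the labels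
of the vertices and of the planar structure. -/
def cofree (k : ℕ) : Submodule K (Tree k → ⨂[K]^k X.E.susp.toDGModule) where
  carrier := {x | (∀ (t : Tree k) (π : Equiv.Perm (Fin k)),
      x (t.relabel 1 π) = X.E.susp.toDGModule.koszul π (x t)) ∧
    ∀ (t t' : Tree k) (y : Fin k), t'.1 = t.1.swapAt y → x t' = X.E.susp.swapFactor y (x t)}
  add_mem' hx hy := ⟨fun t π => by simp [hx.1 t π, hy.1 t π],
    fun t t' y h => by simp [hx.2 t t' y h, hy.2 t t' y h]⟩
  zero_mem' := ⟨fun t π => by simp, fun t t' y h => by simp⟩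
  smul_mem' c _ hx := ⟨fun t π => by simp [hx.1 t π], fun t t' y h => by simp [hx.2 t t' y h]⟩

/-- The three trees which become equal when the edge from the vertex `v` up to the vertex `w` is
contracted. -/
inductive SameContraction {L Y : Type} (v w : Y) : (Fin 3 → BTree L Y) → Prop
  | root (a b c : BTree L Y) : SameContraction v w
      ![.node v (.node w a b) c, .node v (.node w b c) a, .node v (.node w c a) b]
  | left (y : Y) (t : Fin 3 → BTree L Y) (r : BTree L Y) :
      SameContraction v w t → SameContraction v w fun u => .node y (t u) r
  | right (y : Y) (l : BTree L Y) (t : Fin 3 → BTree L Y) :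
      SameContraction v w t → SameContraction v w fun u => .node y l (t u)

/-- The composite in the operad of two suspended generators along the tree `comb u`:
`s μ ⊗ s ν ↦ (-1)^|μ| μ ∘ ν`. -/
def composeTwo (u : Fin 3) : (⨂[K]^2 X.E.susp.toDGModule) →ₗ[K] X.Op 2 :=
  X.E.tree X.rels (Tree.comb u) ∘ₗ PiTensorProduct.map fun j =>
    (if j = 0 then X.E.toDGModule.eps else LinearMap.id) ∘ₗ X.E.desusp

/-- Compose the decorations of the vertices `0` and `1`, as those of the tree `comb u`. -/
def contract (j : ℕ) (u : Fin 3) :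
    (⨂[K]^(j + 2) X.E.susp.toDGModule) →ₗ[K] X.Op 2 ⊗[K] (⨂[K]^j X.E.susp.toDGModule) :=
  TensorProduct.map (X.composeTwo u) LinearMap.id ∘ₗ
    (PiTensorProduct.tmulEquiv K X.E.susp.toDGModule).symm.toLinearMap ∘ₗ
      (PiTensorProduct.reindex K (fun _ : Fin (j + 2) => (X.E.susp.toDGModule : Type v))
        (finSumFinEquiv.trans (finCongr (Nat.add_comm 2 j))).symm).toLinearMap

/-- The kernel of `d₂` on the cofree cooperad. The component of `d₂ x` at a tree with one ternary
vertex is the sum, over the three binary trees which give this tree when an edge is contracted,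
of the composites along this edge; by the compatibility of `x` with changes of the labels of the
vertices one may assume that the edge connects the vertices `0` and `1`. -/
def coop : (k : ℕ) → Submodule K (Tree k → ⨂[K]^k X.E.susp.toDGModule)
  | 0 => X.cofree 0
  | 1 => X.cofree 1
  | j + 2 => X.cofree (j + 2) ⊓
    { carrier := {x | ∀ t : Fin 3 → Tree (j + 2),
        SameContraction 0 1 (fun u => (t u).1) → ∑ u, X.contract j u (x (t u)) = 0}
      add_mem' := fun hx hy t ht => by
        simp only [Pi.add_apply, map_add, Finset.sum_add_distrib, hx t ht, hy t ht, add_zero]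
      zero_mem' := fun t _ => by simp
      smul_mem' := fun c _ hx t ht => by
        simp only [Pi.smul_apply, map_smul, ← Finset.smul_sum, hx t ht, smul_zero] }

/-- The twisting morphism `κ : P^¡ → P`, which is the desuspension on the cogenerators and zero on
the components of weight different from `1`. It is defined on families of decorations. -/
def kappa : (k : ℕ) → (Tree k → ⨂[K]^k X.E.susp.toDGModule) →ₗ[K] X.Op k
  | 1 => X.E.tree X.rels Tree.corolla ∘ₗ (PiTensorProduct.map fun _ => X.E.desusp) ∘ₗ
      LinearMap.proj Tree.corolla
  | _ => 0

end QuadraticData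

/-! ## Algebras, modules and coalgebras -/

/-- An algebra over the operad presented by `X`: a chain complex `A` with a morphism `act` of dg
operads to the endomorphism operad of `A`. -/
structure OpAlgebra (X : QuadraticData.{u, v} K) extends DGModule.{u, w} K where
  act : ∀ k : ℕ, X.Op k →ₗ[K] (⨂[K]^(k + 1) carrier) →ₗ[K] carrier
  act_mem : ∀ (k : ℕ) (p : ℤ) (μ : X.Op k) (r : Fin (k + 1) → ℤ) (a : Fin (k + 1) → carrier),
    μ ∈ X.E.grQ X.rels k p → (∀ i, a i ∈ gr (r i)) →
      act k μ (PiTensorProduct.tprod K a) ∈ gr (p + ∑ i, r i)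
  act_d : ∀ (k : ℕ) (p : ℤ) (μ : X.Op k) (r : Fin (k + 1) → ℤ) (a : Fin (k + 1) → carrier),
    μ ∈ X.E.grQ X.rels k p → (∀ i, a i ∈ gr (r i)) →
      d (act k μ (PiTensorProduct.tprod K a)) =
        act k (X.E.diff X.rels k μ) (PiTensorProduct.tprod K a) +
          ∑ i, ((-1 : K) ^ (p + ∑ j with j < i, r j)) •
            act k μ (PiTensorProduct.tprod K (Function.update a i (d (a i))))
  act_unit : ∀ a : carrier,
    act 0 (X.E.unit X.rels) (PiTensorProduct.tprod K fun _ => a) = a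
  act_perm : ∀ (k : ℕ) (σ : Equiv.Perm (Fin (k + 1))) (μ : X.Op k) (r : Fin (k + 1) → ℤ)
    (a : Fin (k + 1) → carrier), (∀ i, a i ∈ gr (r i)) →
      act k (X.E.perm X.rels σ μ) (PiTensorProduct.tprod K a) =
        DGModule.koszulSign (K := K) σ (fun i => decide (Odd (r (σ i)))) •
          act k μ (PiTensorProduct.tprod K fun i => a (σ i))
  act_comp : ∀ (k l : ℕ) (i : Fin (k + 1)) (p : ℤ) (μ : X.Op k) (ν : X.Op l)
    (r : Fin (k + l + 1) → ℤ) (a : Fin (k + l + 1) → carrier),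
    ν ∈ X.E.grQ X.rels l p → (∀ j, a j ∈ gr (r j)) →
      act (k + l) (X.E.comp X.rels l i μ ν) (PiTensorProduct.tprod K a) =
        ((-1 : K) ^ (p * ∑ j with j < i, r (outerPlace l i j))) •
          act k μ (PiTensorProduct.tprod K fun j =>
            if j = i then act l ν (PiTensorProduct.tprod K fun q => a (innerPlace i q))
            else a (outerPlace l i j))

/-- A module over the algebra `A`: a chain complex `M` with operations
`act k j μ (a₀, …, aⱼ₋₁, aⱼ₊₁, …, aₖ) m`, the value of `μ` on `a₀, …, m, …, aₖ` with `m` in place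
`j`. -/
structure OpModule {X : QuadraticData.{u, v} K} (A : OpAlgebra.{u, v, w} X) extends
    DGModule.{u, w'} K where
  act : ∀ (k : ℕ) (j : Fin (k + 1)), X.Op k →ₗ[K]
    (⨂[K] _ : {i : Fin (k + 1) // i ≠ j}, A.toDGModule) →ₗ[K] carrier →ₗ[K] carrier
  act_mem : ∀ (k : ℕ) (j : Fin (k + 1)) (p : ℤ) (μ : X.Op k) (r : Fin (k + 1) → ℤ)
    (a : Fin (k + 1) → A.toDGModule) (m : carrier),
    μ ∈ X.E.grQ X.rels k p → (∀ i, i ≠ j → a i ∈ A.gr (r i)) → m ∈ gr (r j) →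
      act k j μ (PiTensorProduct.tprod K fun i => a i) m ∈ gr (p + ∑ i, r i)
  act_d : ∀ (k : ℕ) (j : Fin (k + 1)) (p : ℤ) (μ : X.Op k) (r : Fin (k + 1) → ℤ)
    (a : Fin (k + 1) → A.toDGModule) (m : carrier),
    μ ∈ X.E.grQ X.rels k p → (∀ i, i ≠ j → a i ∈ A.gr (r i)) → m ∈ gr (r j) →
      d (act k j μ (PiTensorProduct.tprod K fun i => a i) m) =
        act k j (X.E.diff X.rels k μ) (PiTensorProduct.tprod K fun i => a i) m +
          ∑ i, ((-1 : K) ^ (p + ∑ i' with i' < i, r i')) •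
            if i = j then act k j μ (PiTensorProduct.tprod K fun i' => a i') (d m)
            else act k j μ
              (PiTensorProduct.tprod K fun i' => Function.update a i (A.d (a i)) i') m
  act_unit : ∀ m : carrier,
    act 0 0 (X.E.unit X.rels) (PiTensorProduct.tprod K fun _ => 0) m = m
  act_perm : ∀ (k : ℕ) (j : Fin (k + 1)) (σ : Equiv.Perm (Fin (k + 1))) (μ : X.Op k)
    (r : Fin (k + 1) → ℤ) (a : Fin (k + 1) → A.toDGModule) (m : carrier),
    (∀ i, i ≠ σ j → a i ∈ A.gr (r i)) → m ∈ gr (r (σ j)) →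
      act k (σ j) (X.E.perm X.rels σ μ) (PiTensorProduct.tprod K fun i => a i) m =
        DGModule.koszulSign (K := K) σ (fun i => decide (Odd (r (σ i)))) •
          act k j μ (PiTensorProduct.tprod K fun i => a (σ i)) m
  act_comp_outer : ∀ (k l : ℕ) (i j : Fin (k + 1)) (p : ℤ) (μ : X.Op k) (ν : X.Op l)
    (r : Fin (k + l + 1) → ℤ) (a : Fin (k + l + 1) → A.toDGModule) (m : carrier), j ≠ i →
    ν ∈ X.E.grQ X.rels l p → (∀ q, q ≠ outerPlace l i j → a q ∈ A.gr (r q)) →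
    m ∈ gr (r (outerPlace l i j)) →
      act (k + l) (outerPlace l i j) (X.E.comp X.rels l i μ ν)
          (PiTensorProduct.tprod K fun q => a q) m =
        ((-1 : K) ^ (p * ∑ j' with j' < i, r (outerPlace l i j'))) •
          act k j μ (PiTensorProduct.tprod K fun j' =>
            if j'.1 = i then A.act l ν (PiTensorProduct.tprod K fun q => a (innerPlace i q))
            else a (outerPlace l i j')) m
  act_comp_inner : ∀ (k l : ℕ) (i : Fin (k + 1)) (j : Fin (l + 1)) (p : ℤ) (μ : X.Op k)
    (ν : X.Op l) (r : Fin (k + l + 1) → ℤ) (a : Fin (k + l + 1) → A.toDGModule) (m : carrier),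
    ν ∈ X.E.grQ X.rels l p → (∀ q, q ≠ innerPlace i j → a q ∈ A.gr (r q)) →
    m ∈ gr (r (innerPlace i j)) →
      act (k + l) (innerPlace i j) (X.E.comp X.rels l i μ ν)
          (PiTensorProduct.tprod K fun q => a q) m =
        ((-1 : K) ^ (p * ∑ j' with j' < i, r (outerPlace l i j'))) •
          act k i μ (PiTensorProduct.tprod K fun j' => a (outerPlace l i j'))
            (act l j ν (PiTensorProduct.tprod K fun q => a (innerPlace i q)) m)

section Coalgebra

variable (X : QuadraticData.{u, v} K) (V : DGModule.{u, w} K)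

/-- The value at the tree `t` of the component in arity `k + 1` of an element of `P^¡(V)`. -/
def evalTree {k : ℕ} (t : Tree k) :
    (⨁ k : ℕ, X.coop k ⊗[K] (⨂[K]^(k + 1) V)) →ₗ[K]
      (⨂[K]^k X.E.susp.toDGModule) ⊗[K] (⨂[K]^(k + 1) V) :=
  TensorProduct.map (LinearMap.proj t ∘ₗ (X.coop k).subtype) LinearMap.id ∘ₗ
    DirectSum.component K ℕ (fun k => X.coop k ⊗[K] (⨂[K]^(k + 1) V)) k

/-- The component of degree `p` of `(sE)^{⊗ k} ⊗ V^{⊗ n}`. -/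
def mixedGr (k n : ℕ) (p : ℤ) :
    Submodule K ((⨂[K]^k X.E.susp.toDGModule) ⊗[K] (⨂[K]^n V)) :=
  Submodule.span K {z | ∃ (p₁ p₂ : ℤ) (x : ⨂[K]^k X.E.susp.toDGModule) (y : ⨂[K]^n V),
    x ∈ X.E.susp.toDGModule.tensGr k p₁ ∧ y ∈ V.tensGr n p₂ ∧ p₁ + p₂ = p ∧ z = x ⊗ₜ[K] y}

/-- The differential of `(sE)^{⊗ k} ⊗ V^{⊗ n}`. -/
def mixedD (k n : ℕ) : ((⨂[K]^k X.E.susp.toDGModule) ⊗[K] (⨂[K]^n V)) →ₗ[K]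
    ((⨂[K]^k X.E.susp.toDGModule) ⊗[K] (⨂[K]^n V)) :=
  TensorProduct.map (X.E.susp.toDGModule.tensD k) LinearMap.id +
    TensorProduct.map (X.E.susp.toDGModule.tensEps k) (V.tensD n)

/-- Apply `f : V → (sE)^{⊗ l} ⊗ V^{⊗ (l + 1)}` to the factor in place `i` and move the factor
`(sE)^{⊗ l}` of the result to the front, with the Koszul sign:
`v₀ ⊗ ⋯ ⊗ vₖ ↦ ∑ (-1)^(|x| (|v₀| + ⋯ + |vᵢ₋₁|)) x ⊗ (v₀ ⊗ ⋯ ⊗ w ⊗ ⋯ ⊗ vₖ)` if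
`f vᵢ = ∑ x ⊗ w`. -/
def applyAt {k : ℕ} (l : ℕ) (i : Fin (k + 1))
    (f : V →ₗ[K] (⨂[K]^l X.E.susp.toDGModule) ⊗[K] (⨂[K]^(l + 1) V)) :
    (⨂[K]^(k + 1) V) →ₗ[K]
      (⨂[K]^l X.E.susp.toDGModule) ⊗[K] (⨂[K]^(k + l + 1) V) :=
  TensorProduct.map LinearMap.id (merge K V l i).toLinearMap ∘ₗ
    (TensorProduct.leftComm K (⨂[K] _ : {j : Fin (k + 1) // j ≠ i}, V)
      (⨂[K]^l X.E.susp.toDGModule) (⨂[K]^(l + 1) V)).toLinearMap ∘ₗ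
    (∑ b : Bool, TensorProduct.map
      (PiTensorProduct.map fun j => if j.1 < i ∧ b = true then V.eps else LinearMap.id)
      (TensorProduct.map
        ((2⁻¹ : K) • (if b then LinearMap.id - X.E.susp.toDGModule.tensEps l
          else LinearMap.id + X.E.susp.toDGModule.tensEps l))
        LinearMap.id)) ∘ₗ
    TensorProduct.map LinearMap.id f ∘ₗ (split K V i).toLinearMap

end Coalgebra

/-- A coalgebra over the Koszul dual cooperad `P^¡` of the operad presented by `X`: a chain complex
`C` with a map `coact` of chain complexes to `⨁ₙ (P^¡(n) ⊗ C^{⊗ n})^{𝕊ₙ}`, compatible with the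
decomposition maps and the counit of `P^¡`. The partial decomposition of a family `x` of
decorations in arity `k + l + 1` is the family `(t, s) ↦ x (t ∘ᵢ s)`. -/
structure OpCoalgebra (X : QuadraticData.{u, v} K) extends DGModule.{u, w} K where
  coact : carrier →ₗ[K] ⨁ k : ℕ, X.coop k ⊗[K] (⨂[K]^(k + 1) carrier)
  coact_mem : ∀ (k : ℕ) (t : Tree k) (p : ℤ) (c : carrier), c ∈ gr p →
    evalTree X toDGModule t (coact c) ∈ mixedGr X toDGModule k (k + 1) p
  coact_d : ∀ (k : ℕ) (t : Tree k) (c : carrier),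
    evalTree X toDGModule t (coact (d c)) =
      mixedD X toDGModule k (k + 1) (evalTree X toDGModule t (coact c))
  coact_perm : ∀ (k : ℕ) (t : Tree k) (σ : Equiv.Perm (Fin (k + 1))) (c : carrier),
    evalTree X toDGModule (t.relabel σ 1) (coact c) =
      TensorProduct.map LinearMap.id (toDGModule.koszul σ)
        (evalTree X toDGModule t (coact c))
  coact_counit : ∀ c : carrier, evalTree X toDGModule Tree.one (coact c) =
    PiTensorProduct.tprod K (fun i => i.elim0) ⊗ₜ[K] PiTensorProduct.tprod K fun _ => c
  coact_comp : ∀ (k l : ℕ) (i : Fin (k + 1)) (t : Tree k) (s : Tree l) (c : carrier),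
    evalTree X toDGModule (t.graft i s) (coact c) =
      TensorProduct.map (TensorPower.mulEquiv (R := K) (M := X.E.susp.toDGModule)).toLinearMap
        LinearMap.id
        ((TensorProduct.assoc K (⨂[K]^k X.E.susp.toDGModule) (⨂[K]^l X.E.susp.toDGModule)
          (⨂[K]^(k + l + 1) carrier)).symm
          (TensorProduct.map LinearMap.id
            (applyAt X toDGModule l i (evalTree X toDGModule s ∘ₗ coact))
            (evalTree X toDGModule t (coact c))))

/-! ## The bracket -/

section Bracket

variable {X : QuadraticData.{u, v} K}

/-- The map `κ[φ, g] : C → M` for `φ : C → A` of degree `p` and `g : C → M` of degree `q`. It is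
the sum over the arities `k + 1` of the composites
`C → P^¡(k + 1) ⊗ C^{⊗ (k + 1)} → P(k + 1) ⊗ A^{⊗ k} ⊗ M → M`, where the map in the middle is
`κ ⊗ φ^{⊗ k} ⊗ g` with the Koszul signs and the last map is `act`. -/
def kappaBracketWith (C : OpCoalgebra.{u, v, w} X) (A : DGModule.{u, w'} K)
    (M : DGModule.{u, w''} K)
    (act : ∀ k : ℕ, X.Op k →ₗ[K]
      ((⨂[K] _ : {i : Fin (k + 1) // i ≠ Fin.last k}, A) ⊗[K] M) →ₗ[K] M)
    (p q : ℤ) (φ : C.toDGModule →ₗ[K] A) (g : C.toDGModule →ₗ[K] M) :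
    C.toDGModule →ₗ[K] M :=
  (DirectSum.toModule K ℕ M fun k =>
    TensorProduct.lift (act k) ∘ₗ
      TensorProduct.map
        (X.kappa k ∘ₗ
          (LinearMap.pi fun t =>
            (PiTensorProduct.map fun _ => X.E.susp.toDGModule.epsPow (k * p + q)) ∘ₗ
              LinearMap.proj t) ∘ₗ
          (X.coop k).subtype)
        (TensorProduct.map
          (PiTensorProduct.map fun i =>
            φ ∘ₗ C.toDGModule.epsPow (((k : ℤ) - 1 - (i.1 : ℕ)) * p + q)) g ∘ₗ
          (split K C.toDGModule (Fin.last k)).toLinearMap)) ∘ₗ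
  C.coact

/-- The bracket `κ[φ, ψ]` of `φ, ψ : C → A` of degrees `p` and `q`. -/
def kappaBracket (C : OpCoalgebra.{u, v, w} X) (A : OpAlgebra.{u, v, w'} X) (p q : ℤ)
    (φ ψ : C.toDGModule →ₗ[K] A.toDGModule) : C.toDGModule →ₗ[K] A.toDGModule :=
  kappaBracketWith C A.toDGModule A.toDGModule
    (fun k => LinearMap.lcomp K A.toDGModule
      (split K A.toDGModule (Fin.last k)).symm.toLinearMap ∘ₗ A.act k) p q φ ψ

/-- The bracket `κ[φ, g]` of `φ : C → A` of degree `p` and `g : C → M` of degree `q`. -/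
def kappaAction (C : OpCoalgebra.{u, v, w} X) {A : OpAlgebra.{u, v, w'} X}
    (M : OpModule.{u, v, w', w''} A) (p q : ℤ)
    (φ : C.toDGModule →ₗ[K] A.toDGModule) (g : C.toDGModule →ₗ[K] M.toDGModule) :
    C.toDGModule →ₗ[K] M.toDGModule :=
  kappaBracketWith C A.toDGModule M.toDGModule
    (fun k => (TensorProduct.lift.equiv (RingHom.id K) _ _ _).toLinearMap ∘ₗ
      M.act k (Fin.last k)) p q φ g

end Bracket

/-! ## Differential graded Lie algebras and modules -/

/-- The family `gr p` of subspaces of `L`, with `d p` on `gr p` and `br p q` on `gr p × gr q`, is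
a differential graded Lie algebra. -/
structure IsDGLieAlgebra {L : Type w} [AddCommGroup L] [Module K L] (gr : ℤ → Submodule K L)
    (d : ℤ → L → L) (br : ℤ → ℤ → L → L → L) : Prop where
  d_mem : ∀ p, ∀ x ∈ gr p, d p x ∈ gr (p - 1)
  d_add : ∀ p, ∀ x ∈ gr p, ∀ y ∈ gr p, d p (x + y) = d p x + d p y
  d_smul : ∀ p, ∀ c : K, ∀ x ∈ gr p, d p (c • x) = c • d p x
  d_d : ∀ p, ∀ x ∈ gr p, d (p - 1) (d p x) = 0
  br_mem : ∀ p q, ∀ x ∈ gr p, ∀ y ∈ gr q, br p q x y ∈ gr (p + q)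
  add_br : ∀ p q, ∀ x ∈ gr p, ∀ x' ∈ gr p, ∀ y ∈ gr q,
    br p q (x + x') y = br p q x y + br p q x' y
  br_add : ∀ p q, ∀ x ∈ gr p, ∀ y ∈ gr q, ∀ y' ∈ gr q,
    br p q x (y + y') = br p q x y + br p q x y'
  smul_br : ∀ p q, ∀ c : K, ∀ x ∈ gr p, ∀ y ∈ gr q, br p q (c • x) y = c • br p q x y
  br_smul : ∀ p q, ∀ c : K, ∀ x ∈ gr p, ∀ y ∈ gr q, br p q x (c • y) = c • br p q x y
  antisymm : ∀ p q, ∀ x ∈ gr p, ∀ y ∈ gr q, br p q x y = -(((-1 : K) ^ (p * q)) • br q p y x)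
  jacobi : ∀ p q r, ∀ x ∈ gr p, ∀ y ∈ gr q, ∀ z ∈ gr r,
    br p (q + r) x (br q r y z) =
      br (p + q) r (br p q x y) z + ((-1 : K) ^ (p * q)) • br q (p + r) y (br p r x z)
  leibniz : ∀ p q, ∀ x ∈ gr p, ∀ y ∈ gr q,
    d (p + q) (br p q x y) =
      br (p - 1) q (d p x) y + ((-1 : K) ^ p) • br p (q - 1) x (d q y)

/-- The family `grN q` of subspaces of `N`, with `dN q` on `grN q` and `act p q` on
`gr p × grN q`, is a differential graded module over the differential graded Lie algebra
`(gr, d, br)`. -/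
structure IsDGLieModule {L : Type w} [AddCommGroup L] [Module K L] (gr : ℤ → Submodule K L)
    (d : ℤ → L → L) (br : ℤ → ℤ → L → L → L) {N : Type w'} [AddCommGroup N] [Module K N]
    (grN : ℤ → Submodule K N) (dN : ℤ → N → N) (act : ℤ → ℤ → L → N → N) : Prop where
  d_mem : ∀ q, ∀ n ∈ grN q, dN q n ∈ grN (q - 1)
  d_add : ∀ q, ∀ m ∈ grN q, ∀ n ∈ grN q, dN q (m + n) = dN q m + dN q n
  d_smul : ∀ q, ∀ c : K, ∀ n ∈ grN q, dN q (c • n) = c • dN q n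
  d_d : ∀ q, ∀ n ∈ grN q, dN (q - 1) (dN q n) = 0
  act_mem : ∀ p q, ∀ x ∈ gr p, ∀ n ∈ grN q, act p q x n ∈ grN (p + q)
  add_act : ∀ p q, ∀ x ∈ gr p, ∀ x' ∈ gr p, ∀ n ∈ grN q,
    act p q (x + x') n = act p q x n + act p q x' n
  act_add : ∀ p q, ∀ x ∈ gr p, ∀ m ∈ grN q, ∀ n ∈ grN q,
    act p q x (m + n) = act p q x m + act p q x n
  smul_act : ∀ p q, ∀ c : K, ∀ x ∈ gr p, ∀ n ∈ grN q, act p q (c • x) n = c • act p q x n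
  act_smul : ∀ p q, ∀ c : K, ∀ x ∈ gr p, ∀ n ∈ grN q, act p q x (c • n) = c • act p q x n
  jacobi : ∀ p q r, ∀ x ∈ gr p, ∀ y ∈ gr q, ∀ n ∈ grN r,
    act p (q + r) x (act q r y n) =
      act (p + q) r (br p q x y) n + ((-1 : K) ^ (p * q)) • act q (p + r) y (act p r x n)
  leibniz : ∀ p q, ∀ x ∈ gr p, ∀ n ∈ grN q,
    dN (p + q) (act p q x n) =
      act (p - 1) q (d p x) n + ((-1 : K) ^ p) • act p (q - 1) x (dN q n)

/-! ### The shift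

A bracket `κ[-,-]` of degree `-1` on a graded space `H` is made a bracket of degree `0` on the
graded space with components `L_p = H_{p+1}`, namely `{φ, ψ} = (-1)^p κ[φ, ψ]` for `φ ∈ L_p`,
that is, for `φ` of degree `p + 1` in `H`. -/

/-- The shifted grading `L_p = Hom(C, A)_{p + 1}`. -/
def shiftedHom (V : DGModule.{u, v} K) (W : DGModule.{u, w} K) (p : ℤ) : Submodule K (V →ₗ[K] W) :=
  DGModule.hom V W (p + 1)

/-- The differential `∂` on the shifted graded space. -/
def shiftedD (V : DGModule.{u, v} K) (W : DGModule.{u, w} K) (p : ℤ) (f : V →ₗ[K] W) : V →ₗ[K] W :=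
  DGModule.homD V W (p + 1) f

/-- The bracket of degree `0` on the shifted graded space. -/
def shiftedBracket {X : QuadraticData.{u, v} K} (C : OpCoalgebra.{u, v, w} X)
    (A : OpAlgebra.{u, v, w'} X) (p q : ℤ)
    (φ ψ : C.toDGModule →ₗ[K] A.toDGModule) : C.toDGModule →ₗ[K] A.toDGModule :=
  ((-1 : K) ^ p) • kappaBracket C A (p + 1) (q + 1) φ ψ

/-- The action of the shifted graded space on `Hom(C, M)`. -/
def shiftedAction {X : QuadraticData.{u, v} K} (C : OpCoalgebra.{u, v, w} X)
    {A : OpAlgebra.{u, v, w'} X} (M : OpModule.{u, v, w', w''} A) (p q : ℤ) (φ : C.toDGModule →ₗ[K] A.toDGModule)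
    (g : C.toDGModule →ₗ[K] M.toDGModule) : C.toDGModule →ₗ[K] M.toDGModule :=
  ((-1 : K) ^ p) • kappaAction C M (p + 1) q φ g

end

end OperadLie

namespace OperadLie

noncomputable section

variable {K : Type u} [Field K]

/-! ## Signs -/

/-! Since `κ` is concentrated in weight 1, `κ[φ, g]` only sees the value of the coaction at the
corolla, a coproduct with values in `sE ⊗ C ⊗ C` (`coprod`, `kappaAction_eq`). Both sides of every
identity are then determined by homogeneous pure tensors, where the identity splits into a
structural fact about `C`, `A`, `M` and a comparison of exponents of `-1` modulo 2.

The Jacobi identity is where Koszul duality enters. By coassociativity of `C` and compatibility of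
the actions with operadic composition, `κ[κ[φ,ψ],g]` and `κ[φ,κ[ψ,g]]` can both be read off from the
weight 2 part of the coaction: evaluate it at a tree with two vertices, compose the two decorations
in `P` along this tree, and let the result act on `φ`, `ψ`, `g` (`treeTensor`). The trees are `((0
1) 2)` and `(0 (1 2))`; exchanging `φ` and `ψ` in the second iterated bracket gives `((2 0) 1)` up
to planar structure (`treeTensor_relabel`). These are the three binary trees which contract to the
ternary corolla, and an element of the kernel of `d₂` has vanishing sum of composites along them
(`sum_composeAlong_eq_zero`, `sum_treeTensor_comb`). Thus `kappaAction_jacobi` is the equation `d₂ =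
0` evaluated on `φ`, `ψ`, `g`; in other words, `κ` is a twisting morphism.

The Leibniz rule (`kappaAction_homD`) holds because coaction and action are chain maps and
desuspension anticommutes with the differentials. The symmetry of the bracket (`kappaBracket_swap`)
is the equivariance of coaction and action under `𝕊₂`.

Apart from antisymmetry, every axiom of the Lie algebra is the module statement for `A` as a module
over itself (`OpAlgebra.selfModule`), so the computations are made once, for modules. -/

theorem neg_one_zpow_add (m n : ℤ) : (-1 : K) ^ (m + n) = (-1) ^ m * (-1) ^ n :=
  zpow_add₀ (neg_ne_zero.2 one_ne_zero) m n

theorem neg_neg_one_zpow (m : ℤ) : -(-1 : K) ^ m = (-1) ^ (m + 1) := by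
  rw [neg_one_zpow_add, zpow_one, mul_neg_one]

/-- The longer sign verifications below are reduced by this to an identity in `ZMod 2` between
polynomials in the degrees. -/
theorem neg_one_zpow_congr {m n : ℤ} (h : (m : ZMod 2) = n) : (-1 : K) ^ m = (-1) ^ n := by
  have h2 : Even (m - n) := by
    rw [← ZMod.intCast_eq_zero_iff_even]
    push_cast
    rw [h, sub_self]
  rw [← sub_add_cancel m n, neg_one_zpow_add, h2.neg_one_zpow, one_mul]

theorem neg_one_zpow_sum {ι : Type*} (s : Finset ι) (f : ι → ℤ) :
    (-1 : K) ^ (∑ i ∈ s, f i) = ∏ i ∈ s, (-1 : K) ^ f i := by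
  classical
  induction s using Finset.induction_on with
  | empty => simp
  | insert a s ha ih => rw [Finset.sum_insert ha, Finset.prod_insert ha, neg_one_zpow_add, ih]

/-- Translates the case distinction on the parity of `n` in `epsPow` into an exponent that can be
added to others. -/
theorem zpow_mul_eq_zpow_ite (n p : ℤ) :
    (-1 : K) ^ (n * p) = if Even n then 1 else (-1 : K) ^ p := by
  split_ifs with h
  · exact (h.mul_right p).neg_one_zpow
  · refine neg_one_zpow_congr ?_
    have h1 : (n : ZMod 2) = 1 := by
      rw [ZMod.intCast_eq_one_iff_odd]
      exact Int.not_even_iff_odd.1 h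
    push_cast
    rw [h1, one_mul]

/-! ### Sign operators, permutations and differentials on homogeneous pure tensors -/

namespace DGModule

variable (V : DGModule.{u, v} K)

theorem iSup_gr : ⨆ p, V.gr p = ⊤ :=
  ((DirectSum.isInternal_submodule_iff_iSupIndep_and_iSup_eq_top V.gr).1 V.internal).2

variable {V} in
/-- Linear maps which agree on homogeneous elements are equal. -/
theorem linearMap_ext {W : Type w} [AddCommGroup W] [Module K W] {f f' : V →ₗ[K] W}
    (h : ∀ p, ∀ x ∈ V.gr p, f x = f' x) : f = f' := by
  rw [← LinearMap.eqLocus_eq_top, eq_top_iff, ← V.iSup_gr, iSup_le_iff]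
  exact h

theorem epsPow_apply (n : ℤ) {p : ℤ} {x : V} (hx : x ∈ V.gr p) :
    V.epsPow n x = (-1 : K) ^ (n * p) • x := by
  rw [zpow_mul_eq_zpow_ite, epsPow]
  split_ifs
  · simp
  · exact V.eps_apply hx

theorem parity_apply [CharZero K] (b : Bool) {p : ℤ} {x : V} (hx : x ∈ V.gr p) :
    V.parity b x = if decide (Odd p) = b then x else 0 := by
  have h2 : (2⁻¹ : K) • x + (2⁻¹ : K) • x = x := by
    rw [← smul_add, ← two_smul K, smul_smul, inv_mul_cancel₀ two_ne_zero, one_smul]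
  rcases Int.even_or_odd p with hp | hp
  · have h : ¬ Odd p := Int.not_odd_iff_even.2 hp
    cases b <;> simp [parity, V.eps_apply hx, hp.neg_one_zpow, h, h2]
  · cases b <;> simp [parity, V.eps_apply hx, hp.neg_one_zpow, hp, h2]

theorem tensEps_tprod {n : ℕ} (r : Fin n → ℤ) (x : Fin n → V) (hx : ∀ i, x i ∈ V.gr (r i)) :
    V.tensEps n (PiTensorProduct.tprod K x) =
      (-1 : K) ^ (∑ i, r i) • PiTensorProduct.tprod K x := by
  rw [tensEps, PiTensorProduct.map_tprod, neg_one_zpow_sum, ← MultilinearMap.map_smul_univ]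
  congr 1
  funext i
  exact V.eps_apply (hx i)

theorem koszul_tprod [CharZero K] {n : ℕ} (σ : Equiv.Perm (Fin n)) (r : Fin n → ℤ) (x : Fin n → V)
    (hx : ∀ i, x i ∈ V.gr (r i)) :
    V.koszul σ (PiTensorProduct.tprod K x) =
      koszulSign (K := K) σ (fun i => decide (Odd (r i))) •
        PiTensorProduct.tprod K fun i => x (σ.symm i) := by
  -- Only the actual parity pattern survives: for any other pattern some factor is killed by its
  -- parity projection.
  rw [koszul, LinearMap.sum_apply, Finset.sum_eq_single fun i => decide (Odd (r i))]
  · simp only [LinearMap.smul_apply, LinearMap.comp_apply, PiTensorProduct.map_tprod,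
      LinearEquiv.coe_coe, PiTensorProduct.reindex_tprod]
    congr 2
    funext i
    rw [V.parity_apply _ (hx _), if_pos rfl]
  · intro q' _ hq
    obtain ⟨i, hi⟩ := Function.ne_iff.1 hq
    simp only [LinearMap.smul_apply, LinearMap.comp_apply, PiTensorProduct.map_tprod]
    rw [MultilinearMap.map_coord_zero _ i, map_zero, smul_zero]
    rw [V.parity_apply _ (hx _), if_neg (Ne.symm hi)]
  · simp

theorem tensD_tprod {n : ℕ} (r : Fin n → ℤ) (x : Fin n → V) (hx : ∀ i, x i ∈ V.gr (r i)) :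
    V.tensD n (PiTensorProduct.tprod K x) =
      ∑ i, (-1 : K) ^ (∑ j with j < i, r j) •
        PiTensorProduct.tprod K (Function.update x i (V.d (x i))) := by
  rw [tensD, LinearMap.sum_apply]
  refine Finset.sum_congr rfl fun i _ => ?_
  -- The sign is written as a product over all places, with trivial factors for `j ≥ i`, so that
  -- multilinearity distributes it over the tensor factors.
  have h : (-1 : K) ^ (∑ j with j < i, r j) = ∏ j, if j < i then (-1 : K) ^ r j else 1 := by
    rw [neg_one_zpow_sum, Finset.prod_filter]
  rw [PiTensorProduct.map_tprod, h, ← MultilinearMap.map_smul_univ]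
  congr 1
  funext j
  by_cases h1 : j < i
  · simp [h1, h1.ne, V.eps_apply (hx j)]
  · by_cases h2 : j = i
    · subst h2
      simp
    · simp [h1, h2]

/-! ### The complex of homogeneous maps -/

variable {V} {W : DGModule.{u, w} K}

theorem homD_mem {p : ℤ} {f : V →ₗ[K] W} (hf : f ∈ hom V W p) : homD V W p f ∈ hom V W (p - 1) := by
  intro i x hx
  refine (W.gr _).sub_mem ?_ ((W.gr _).smul_mem _ ?_)
  · have := W.d_mem _ _ (hf i x hx)
    rwa [add_sub_assoc] at this
  · have := hf _ _ (V.d_mem _ _ hx)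
    rwa [sub_add_eq_add_sub, ← add_sub_assoc] at *

theorem homD_homD (p : ℤ) (f : V →ₗ[K] W) : homD V W (p - 1) (homD V W p f) = 0 := by
  ext x
  have h : (-1 : K) ^ (p - 1) = -(-1) ^ p := by
    rw [sub_eq_add_neg, neg_one_zpow_add]
    simp
  simp [homD, W.d_d, V.d_d, h]

theorem homD_add (p : ℤ) (f g : V →ₗ[K] W) :
    homD V W p (f + g) = homD V W p f + homD V W p g := by
  simp only [homD, LinearMap.comp_add, LinearMap.add_comp, smul_add]
  abel

theorem homD_smul (p : ℤ) (c : K) (f : V →ₗ[K] W) :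
    homD V W p (c • f) = c • homD V W p f := by
  simp only [homD, LinearMap.comp_smul, LinearMap.smul_comp, smul_sub, smul_comm c]

end DGModule

/-! ## Homogeneous pure tensors -/

section MixedGr

variable (X : QuadraticData.{u, v} K) (V : DGModule.{u, w} K)

/-- A subspace which contains the homogeneous pure tensors of degree `p` contains all elements of
degree `p`. -/
theorem mixedGr_le {k n : ℕ} {p : ℤ}
    (N : Submodule K ((⨂[K]^k X.E.susp.toDGModule) ⊗[K] (⨂[K]^n V)))
    (h : ∀ (r : Fin k → ℤ) (e : Fin k → X.E.susp.toDGModule) (s : Fin n → ℤ) (x : Fin n → V),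
      (∀ i, e i ∈ X.E.susp.gr (r i)) → (∀ i, x i ∈ V.gr (s i)) → ∑ i, r i + ∑ i, s i = p →
        PiTensorProduct.tprod K e ⊗ₜ[K] PiTensorProduct.tprod K x ∈ N) :
    mixedGr X V k n p ≤ N := by
  rw [mixedGr, Submodule.span_le]
  rintro _ ⟨p₁, p₂, x, y, hx, hy, hp, rfl⟩
  rw [SetLike.mem_coe]
  induction hx using Submodule.span_induction with
  | zero => simp
  | add a b _ _ ha hb => rw [TensorProduct.add_tmul]; exact N.add_mem ha hb
  | smul c a _ ha => rw [← TensorProduct.smul_tmul']; exact N.smul_mem c ha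
  | mem x hx =>
    obtain ⟨r, e, he, hr, rfl⟩ := hx
    induction hy using Submodule.span_induction with
    | zero => simp
    | add a b _ _ ha hb => rw [TensorProduct.tmul_add]; exact N.add_mem ha hb
    | smul c a _ ha => rw [TensorProduct.tmul_smul]; exact N.smul_mem c ha
    | mem y hy =>
      obtain ⟨s, x, hx, hs, rfl⟩ := hy
      exact h r e s x he hx (by rw [hr, hs, hp])

variable {X V} in
/-- Linear maps which agree on the homogeneous pure tensors of degree `p` agree on the component
of degree `p`. -/
theorem eq_of_mem_mixedGr {W : Type w'} [AddCommGroup W] [Module K W] {k n : ℕ} {p : ℤ}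
    {f f' : ((⨂[K]^k X.E.susp.toDGModule) ⊗[K] (⨂[K]^n V)) →ₗ[K] W}
    {z : (⨂[K]^k X.E.susp.toDGModule) ⊗[K] (⨂[K]^n V)} (hz : z ∈ mixedGr X V k n p)
    (h : ∀ (r : Fin k → ℤ) (e : Fin k → X.E.susp.toDGModule) (s : Fin n → ℤ) (x : Fin n → V),
      (∀ i, e i ∈ X.E.susp.gr (r i)) → (∀ i, x i ∈ V.gr (s i)) → ∑ i, r i + ∑ i, s i = p →
        f (PiTensorProduct.tprod K e ⊗ₜ[K] PiTensorProduct.tprod K x) =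
          f' (PiTensorProduct.tprod K e ⊗ₜ[K] PiTensorProduct.tprod K x)) :
    f z = f' z :=
  mixedGr_le X V (LinearMap.eqLocus f f') h hz

end MixedGr

/-! ### Separating and inserting tensor factors -/

section Split

variable (V : Type v) [AddCommGroup V] [Module K V]

theorem split_tprod {k : ℕ} (i : Fin (k + 1)) (x : Fin (k + 1) → V) :
    split K V i (PiTensorProduct.tprod K x) =
      (PiTensorProduct.tprod K fun j => x j.1) ⊗ₜ[K] x i := by
  simp only [split, LinearEquiv.trans_apply]
  erw [PiTensorProduct.reindex_tprod, PiTensorProduct.tmulEquiv_symm_apply]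
  erw [TensorProduct.congr_tmul, PiTensorProduct.subsingletonEquiv_apply_tprod]
  rfl

/-- The entry `x i` is a dummy which `y` overwrites. Module operations are given families over all
places with such a dummy at the module's place, hence the form with `Function.update`. -/
theorem split_symm_tmul {k : ℕ} (i : Fin (k + 1)) (x : Fin (k + 1) → V) (y : V) :
    (split K V i).symm ((PiTensorProduct.tprod K fun j => x j.1) ⊗ₜ[K] y) =
      PiTensorProduct.tprod K (Function.update x i y) := by
  rw [LinearEquiv.symm_apply_eq, split_tprod, Function.update_self]
  congr 2
  funext j
  rw [Function.update_of_ne j.2]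

theorem merge_tmul {k l : ℕ} (i : Fin (k + 1)) (x : Fin (k + 1) → V) (y : Fin (l + 1) → V) :
    merge K V l i ((PiTensorProduct.tprod K fun j => x j.1) ⊗ₜ[K] PiTensorProduct.tprod K y) =
      PiTensorProduct.tprod K fun q =>
        Sum.elim (fun j : {j : Fin (k + 1) // j ≠ i} => x j.1) y ((placeEquiv l i).symm q) := by
  simp only [merge, LinearEquiv.trans_apply]
  erw [PiTensorProduct.tmulEquiv_apply, PiTensorProduct.reindex_tprod]

end Split

/-! ## An algebra as a module over itself -/

/-- The algebra `A` as a module over itself. -/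
abbrev OpAlgebra.selfModule {X : QuadraticData.{u, v} K} (A : OpAlgebra.{u, v, w} X) :
    OpModule.{u, v, w, w} A where
  toDGModule := A.toDGModule
  act k j := (TensorProduct.lift.equiv (RingHom.id K) _ _ _).symm.toLinearMap ∘ₗ
    LinearMap.lcomp K A.toDGModule (split K A.toDGModule j).symm.toLinearMap ∘ₗ A.act k
  act_mem k j p μ r a m hμ ha hm := by
    change A.act k μ ((split K A.toDGModule j).symm (_ ⊗ₜ[K] m)) ∈ _
    rw [split_symm_tmul]
    refine A.act_mem k p μ r _ hμ fun i => ?_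
    rcases eq_or_ne i j with rfl | h
    · rwa [Function.update_self]
    · rw [Function.update_of_ne h]
      exact ha i h
  act_d k j p μ r a m hμ ha hm := by
    change A.d (A.act k μ ((split K A.toDGModule j).symm (_ ⊗ₜ[K] m))) =
      A.act k _ ((split K A.toDGModule j).symm (_ ⊗ₜ[K] m)) + ∑ i, _ • if i = j then
        A.act k _ ((split K A.toDGModule j).symm (_ ⊗ₜ[K] A.d m)) else
          A.act k _ ((split K A.toDGModule j).symm (_ ⊗ₜ[K] m))
    simp only [split_symm_tmul]
    rw [A.act_d k p μ r _ hμ]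
    · congr 1
      refine Finset.sum_congr rfl fun i _ => ?_
      congr 1
      split_ifs with h
      · subst h
        rw [Function.update_self, Function.update_idem]
      · rw [Function.update_of_ne h, Function.update_comm h]
    · intro i
      rcases eq_or_ne i j with rfl | h
      · rwa [Function.update_self]
      · rw [Function.update_of_ne h]
        exact ha i h
  act_unit m := by
    change A.act 0 _ ((split K A.toDGModule 0).symm (_ ⊗ₜ[K] m)) = m
    rw [split_symm_tmul (K := K) _ (0 : Fin 1) (fun _ => (0 : A.toDGModule))]
    convert A.act_unit m
    rename_i i
    rw [Fin.fin_one_eq_zero i, Function.update_self]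
  act_perm k j σ μ r a m ha hm := by
    change A.act k _ ((split K A.toDGModule (σ j)).symm (_ ⊗ₜ[K] m)) =
      _ • A.act k μ ((split K A.toDGModule j).symm (_ ⊗ₜ[K] m))
    rw [split_symm_tmul, split_symm_tmul (K := K) _ j (fun i => a (σ i)), A.act_perm k σ μ r]
    · congr 3
      funext i
      rcases eq_or_ne i j with rfl | h
      · simp
      · rw [Function.update_of_ne h, Function.update_of_ne (σ.injective.ne h)]
    · intro i
      rcases eq_or_ne i (σ j) with rfl | h
      · rwa [Function.update_self]
      · rw [Function.update_of_ne h]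
        exact ha i h
  act_comp_outer k l i j p μ ν r a m hij hν ha hm := by
    change A.act _ _ ((split K A.toDGModule (outerPlace l i j)).symm (_ ⊗ₜ[K] m)) =
      _ • A.act k μ ((split K A.toDGModule j).symm (_ ⊗ₜ[K] m))
    rw [split_symm_tmul, A.act_comp k l i p μ ν r]
    · rw [split_symm_tmul (K := K) _ j (fun j' => if j' = i then
        A.act l ν (PiTensorProduct.tprod K fun q => a (innerPlace i q)) else a (outerPlace l i j'))]
      congr 3
      -- Distinct inputs of the two operations occupy distinct places of the composite, so the
      -- update at the module's place meets exactly one of them.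
      have inj := (placeEquiv l i).injective
      funext j'
      by_cases h : j' = i
      · subst h
        rw [if_pos rfl, Function.update_of_ne hij.symm, if_pos rfl]
        congr 2
        funext q
        rw [Function.update_of_ne]
        intro h
        exact absurd (@inj (Sum.inr q) (Sum.inl ⟨j, hij⟩) h) (by simp)
      · rw [if_neg h]
        rcases eq_or_ne j' j with rfl | h'
        · simp
        · rw [Function.update_of_ne h', if_neg h, Function.update_of_ne]
          intro h3
          have := @inj (Sum.inl ⟨j', h⟩) (Sum.inl ⟨j, hij⟩) h3
          simp [h'] at this
    · exact hν
    · intro q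
      rcases eq_or_ne q (outerPlace l i j) with rfl | h
      · rwa [Function.update_self]
      · rw [Function.update_of_ne h]
        exact ha q h
  act_comp_inner k l i j p μ ν r a m hν ha hm := by
    change A.act _ _ ((split K A.toDGModule (innerPlace i j)).symm (_ ⊗ₜ[K] m)) =
      _ • A.act k μ ((split K A.toDGModule i).symm (_ ⊗ₜ[K]
        A.act l ν ((split K A.toDGModule j).symm (_ ⊗ₜ[K] m))))
    rw [split_symm_tmul, A.act_comp k l i p μ ν r]
    · rw [split_symm_tmul (K := K) _ j (fun q => a (innerPlace i q)),
        split_symm_tmul (K := K) _ i (fun j' => a (outerPlace l i j'))]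
      congr 3
      have inj := (placeEquiv l i).injective
      funext j'
      by_cases h : j' = i
      · subst h
        rw [if_pos rfl, Function.update_self]
        congr 2
        funext q
        rcases eq_or_ne q j with rfl | h'
        · simp
        · rw [Function.update_of_ne h', Function.update_of_ne]
          intro h
          have := @inj (Sum.inr q) (Sum.inr j) h
          simp [h'] at this
      · rw [if_neg h, Function.update_of_ne h, Function.update_of_ne]
        intro h3
        exact absurd (@inj (Sum.inl ⟨j', h⟩) (Sum.inr j) h3) (by simp)
    · exact hν
    · intro q
      rcases eq_or_ne q (innerPlace i j) with rfl | h
      · rwa [Function.update_self]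
      · rw [Function.update_of_ne h]
        exact ha q h

/-- The operations of `selfModule` are the curried operations of `A`, and the action uncurries them
again. -/
theorem kappaBracket_eq_kappaAction {X : QuadraticData.{u, v} K} (C : OpCoalgebra.{u, v, w'} X)
    (A : OpAlgebra.{u, v, w} X) (p q : ℤ) (φ ψ : C.toDGModule →ₗ[K] A.toDGModule) :
    kappaBracket C A p q φ ψ = kappaAction C A.selfModule p q φ ψ :=
  congrArg (fun act => kappaBracketWith C A.toDGModule A.toDGModule act p q φ ψ)
    (funext fun k => LinearMap.ext fun _ => ((TensorProduct.lift.equiv (RingHom.id K)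
      (⨂[K] _ : {i : Fin (k + 1) // i ≠ Fin.last k}, A.carrier) A.carrier
        A.carrier).apply_symm_apply _).symm)

/-! ## The operad on generators -/

namespace Generators

variable (E : Generators.{u, v} K) (S : Set (E.Raw 2))

theorem tree_mem_grQ {k : ℕ} (t : Tree k) {r : Fin k → ℤ} {e : Fin k → E.toDGModule}
    (he : ∀ i, e i ∈ E.gr (r i)) :
    E.tree S t (PiTensorProduct.tprod K e) ∈ E.grQ S k (∑ i, r i) :=
  Submodule.mem_map_of_mem (Submodule.mem_iSup_of_mem t (Submodule.mem_map_of_mem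
    (Submodule.subset_span ⟨r, e, he, rfl, rfl⟩)))

theorem diff_tree {k : ℕ} (t : Tree k) (a : ⨂[K]^k E.toDGModule) :
    E.diff S k (E.tree S t a) = E.tree S t (E.toDGModule.tensD k a) := by
  simp [diff, tree, rawD]

theorem comp_tree {k l : ℕ} (i : Fin (k + 1)) (t : Tree k) (s : Tree l)
    (a : ⨂[K]^k E.toDGModule) (b : ⨂[K]^l E.toDGModule) :
    E.comp S l i (E.tree S t a) (E.tree S s b) =
      E.tree S (t.graft i s) (TensorPower.mulEquiv (R := K) (M := E.toDGModule) (a ⊗ₜ[K] b)) := by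
  simp [comp, tree, rawComp]

theorem perm_tree {k : ℕ} (σ : Equiv.Perm (Fin (k + 1))) (t : Tree k)
    (a : ⨂[K]^k E.toDGModule) :
    E.perm S σ (E.tree S t a) = E.tree S (t.relabel σ 1) a := by
  simp [perm, tree, rawPerm]

theorem tree_swapAt {k : ℕ} {t t' : Tree k} {y : Fin k} (h : t'.1 = t.1.swapAt y)
    (a : ⨂[K]^k E.toDGModule) : E.tree S t' (E.swapFactor y a) = E.tree S t a :=
  (Submodule.Quotient.eq _).2 (InIdeal.planar k t t' y h a)

end Generators

/-! ## The binary operations of a module -/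

instance : Unique {i : Fin 2 // i ≠ 1} where
  default := ⟨0, zero_ne_one⟩
  uniq := by decide

namespace OpModule

variable {X : QuadraticData.{u, v} K} {A : OpAlgebra.{u, v, w} X} (M : OpModule.{u, v, w, w'} A)

/-- The binary operation of a module which is given by a generator. -/
def binary : X.E.toDGModule →ₗ[K] A.toDGModule →ₗ[K] M.toDGModule →ₗ[K] M.toDGModule :=
  (M.act 1 1 ∘ₗ X.E.tree X.rels Tree.corolla ∘ₗ
    (PiTensorProduct.subsingletonEquiv (R := K)
      (s := fun _ : Fin 1 => X.E.carrier) 0).symm.toLinearMap).compl₂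
    (PiTensorProduct.subsingletonEquiv (R := K)
      (s := fun _ : {i : Fin 2 // i ≠ 1} => A.carrier) default).symm.toLinearMap

theorem binary_apply (e : X.E.toDGModule) (a : A.toDGModule) (m : M.toDGModule) :
    M.binary e a m = M.act 1 1 (X.E.tree X.rels Tree.corolla (PiTensorProduct.tprod K fun _ => e))
      (PiTensorProduct.tprod K fun _ => a) m := by
  simp only [binary, LinearMap.compl₂_apply, LinearMap.comp_apply, LinearEquiv.coe_coe]
  erw [PiTensorProduct.subsingletonEquiv_symm_apply', PiTensorProduct.subsingletonEquiv_symm_apply']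

theorem corolla_mem {i : ℤ} {e : X.E.toDGModule} (he : e ∈ X.E.gr i) :
    X.E.tree X.rels Tree.corolla (PiTensorProduct.tprod K fun _ => e) ∈ X.E.grQ X.rels 1 i := by
  simpa using X.E.tree_mem_grQ X.rels Tree.corolla (r := fun _ => i) (e := fun _ => e) fun _ => he

theorem binary_mem {i j k : ℤ} {e : X.E.toDGModule} {a : A.toDGModule} {m : M.toDGModule}
    (he : e ∈ X.E.gr i) (ha : a ∈ A.gr j) (hm : m ∈ M.gr k) :
    M.binary e a m ∈ M.gr (i + (j + k)) := by
  rw [binary_apply]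
  have h := M.act_mem 1 1 i _ ![j, k] (fun _ => a) m (corolla_mem he)
    (by intro i hi; fin_cases i; exacts [ha, (hi rfl).elim]) hm
  simpa using h

theorem d_binary {i j k : ℤ} {e : X.E.toDGModule} {a : A.toDGModule} {m : M.toDGModule}
    (he : e ∈ X.E.gr i) (ha : a ∈ A.gr j) (hm : m ∈ M.gr k) :
    M.d (M.binary e a m) = M.binary (X.E.d e) a m + (-1 : K) ^ i • M.binary e (A.d a) m +
      (-1 : K) ^ (i + j) • M.binary e a (M.d m) := by
  simp only [binary_apply]
  have h := M.act_d 1 1 i _ ![j, k] (fun _ => a) m (corolla_mem he)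
    (by intro i hi; fin_cases i; exacts [ha, (hi rfl).elim]) hm
  -- The corolla carries a single decoration, so the operadic differential just replaces `e` by `d
  -- e`, without sign.
  rw [h, Generators.diff_tree, DGModule.tensD_tprod _ (fun _ => i) _ fun _ => he, add_assoc]
  congr 1
  · simp
    congr 3
    congr 1
    refine congrArg (PiTensorProduct.tprod K (s := fun _ : Fin 1 => X.E.carrier))
      (funext fun x => ?_)
    rw [Subsingleton.elim x 0, Function.update_self]
  · have h0 : ({x | x < 1} : Finset (Fin 2)) = {0} := by decide
    simp only [Nat.reduceAdd, Fin.sum_univ_two, h0]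
    simp
    congr 3
    refine congrArg _ (funext fun x => ?_)
    rw [Subsingleton.elim x default]
    exact Function.update_self ..

end OpModule

/-! ## Transpositions -/

theorem ite_odd_and_odd (a b : ℤ) :
    (if Odd a ∧ Odd b then (-1 : K) else 1) = (-1) ^ (a * b) := by
  split_ifs with h
  · exact (h.1.mul h.2).neg_one_zpow.symm
  · rw [← Int.odd_mul, Int.not_odd_iff_even] at h
    exact h.neg_one_zpow.symm

theorem koszulSign_swap_two (r : Fin 2 → ℤ) :
    DGModule.koszulSign (K := K) (Equiv.swap 0 1) (fun i => decide (Odd (r i))) =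
      (-1) ^ (r 0 * r 1) := by
  rw [← ite_odd_and_odd]
  simp [DGModule.koszulSign, Fin.prod_univ_two]

theorem koszulSign_swap_three (r : Fin 3 → ℤ) :
    DGModule.koszulSign (K := K) (Equiv.swap 0 1) (fun i => decide (Odd (r i))) =
      (-1) ^ (r 0 * r 1) := by
  have h2 : (Equiv.swap 0 1 : Equiv.Perm (Fin 3)) 2 = 2 := by decide
  rw [← ite_odd_and_odd]
  simp [DGModule.koszulSign, Fin.prod_univ_three, h2]

/-! ## The values of the coaction -/

section Coaction

variable (X : QuadraticData.{u, v} K)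

theorem QuadraticData.coop_le_cofree (k : ℕ) : X.coop k ≤ X.cofree k := by
  match k with
  | 0 => exact le_rfl
  | 1 => exact le_rfl
  | _ + 2 => exact inf_le_left

variable {X} in
-- The components of the coaction lie in `P^¡`, hence in the cofree cooperad, whose elements are
-- families compatible with changes of planar structure.
theorem evalTree_swapAt {V : DGModule.{u, w} K} {k : ℕ} {t t' : Tree k} {y : Fin k}
    (h : t'.1 = t.1.swapAt y) (z : ⨁ k : ℕ, X.coop k ⊗[K] (⨂[K]^(k + 1) V)) :
    evalTree X V t' z =
      TensorProduct.map (X.E.susp.swapFactor y) LinearMap.id (evalTree X V t z) := by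
  have h1 : LinearMap.proj t' ∘ₗ (X.coop k).subtype =
      X.E.susp.swapFactor y ∘ₗ LinearMap.proj t ∘ₗ (X.coop k).subtype :=
    LinearMap.ext fun x => (X.coop_le_cofree k x.2).2 t t' y h
  rw [evalTree, h1, evalTree, LinearMap.comp_apply, LinearMap.comp_apply,
    ← LinearMap.comp_apply (TensorProduct.map _ _) (TensorProduct.map _ _),
    ← TensorProduct.map_comp, LinearMap.id_comp]

end Coaction

/-! ## The bracket on pure tensors -/

section KappaAction

variable {X : QuadraticData.{u, v} K} (C : OpCoalgebra.{u, v, w} X)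
  {A : OpAlgebra.{u, v, w'} X} (M : OpModule.{u, v, w', w''} A)

/-- The value of the coaction at the corolla. -/
def OpCoalgebra.coprod :
    C.toDGModule →ₗ[K] (⨂[K]^1 X.E.susp.toDGModule) ⊗[K] (⨂[K]^2 C.toDGModule) :=
  evalTree X C.toDGModule Tree.corolla ∘ₗ C.coact

/-- The map `κ ⊗ φ ⊗ g`, with Koszul signs, followed by the action of generators. -/
def kappaTensor (p q : ℤ) (φ : C.toDGModule →ₗ[K] A.toDGModule)
    (g : C.toDGModule →ₗ[K] M.toDGModule) :
    (⨂[K]^1 X.E.susp.toDGModule) ⊗[K] (⨂[K]^2 C.toDGModule) →ₗ[K] M.toDGModule :=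
  TensorProduct.lift ((TensorProduct.lift.equiv (RingHom.id K) _ _ _).toLinearMap ∘ₗ
      M.act 1 (Fin.last 1)) ∘ₗ
    TensorProduct.map
      (X.E.tree X.rels Tree.corolla ∘ₗ (PiTensorProduct.map fun _ => X.E.desusp) ∘ₗ
        PiTensorProduct.map fun _ => X.E.susp.toDGModule.epsPow ((1 : ℕ) * p + q))
      (TensorProduct.map
        (PiTensorProduct.map fun i =>
          φ ∘ₗ C.toDGModule.epsPow ((((1 : ℕ) : ℤ) - 1 - (i.1 : ℕ)) * p + q)) g ∘ₗ
        (split K C.toDGModule (Fin.last 1)).toLinearMap)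

theorem kappaAction_eq (p q : ℤ) (φ : C.toDGModule →ₗ[K] A.toDGModule)
    (g : C.toDGModule →ₗ[K] M.toDGModule) :
    kappaAction C M p q φ g = kappaTensor C M p q φ g ∘ₗ C.coprod := by
  rw [kappaAction, kappaBracketWith, OpCoalgebra.coprod, ← LinearMap.comp_assoc]
  congr 1
  -- Outside arity 2 both sides vanish: on the left because `κ` is zero, on the right because the
  -- value at the corolla only uses the summand of index 1.
  refine DirectSum.linearMap_ext K fun k => ?_
  rw [LinearMap.comp_assoc, evalTree, LinearMap.comp_assoc]
  refine LinearMap.ext fun z => ?_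
  rw [LinearMap.comp_apply, DirectSum.toModule_lof]
  match k, z with
  | 0, z =>
    have h : DirectSum.component K ℕ (fun k => X.coop k ⊗[K] (⨂[K]^(k + 1) C.toDGModule)) 1
        (DirectSum.lof K ℕ _ 0 z) = 0 := by
      rw [DirectSum.component.of, dif_neg (by omega)]
    rw [LinearMap.comp_apply (kappaTensor ..), LinearMap.comp_apply (TensorProduct.map ..),
      LinearMap.comp_apply (DirectSum.component ..), h, map_zero, map_zero]
    simp [QuadraticData.kappa, TensorProduct.map_zero_left]
  | k + 2, z =>
    have h : DirectSum.component K ℕ (fun k => X.coop k ⊗[K] (⨂[K]^(k + 1) C.toDGModule)) 1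
        (DirectSum.lof K ℕ _ (k + 2) z) = 0 := by
      rw [DirectSum.component.of, dif_neg (by omega)]
    rw [LinearMap.comp_apply (kappaTensor ..), LinearMap.comp_apply (TensorProduct.map ..),
      LinearMap.comp_apply (DirectSum.component ..), h, map_zero, map_zero]
    simp [QuadraticData.kappa, TensorProduct.map_zero_left]
  | 1, z =>
    simp only [LinearMap.comp_apply, DirectSum.component.lof_self]
    induction z with
    | zero => simp only [map_zero]
    | add a b ha hb => simp only [map_add, ha, hb]
    | tmul x y => rfl

variable {C M}

/-- The Koszul sign of `κ ⊗ φ ⊗ g` on `e ⊗ x₀ ⊗ x₁`: both `φ` and `g` pass `e`, and `g` also passes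
`x₀`. -/
theorem kappaTensor_tprod {p q : ℤ} {φ : C.toDGModule →ₗ[K] A.toDGModule}
    {g : C.toDGModule →ₗ[K] M.toDGModule} {r s : ℤ} {e : Fin 1 → X.E.susp.toDGModule}
    {x : Fin 2 → C.toDGModule} (he : e 0 ∈ X.E.susp.gr r) (hx : x 0 ∈ C.gr s) :
    kappaTensor C M p q φ g (PiTensorProduct.tprod K e ⊗ₜ[K] PiTensorProduct.tprod K x) =
      (-1 : K) ^ ((p + q) * r + q * s) • M.binary (e 0) (φ (x 0)) (g (x 1)) := by
  have h1 : (fun i => X.E.desusp (X.E.susp.toDGModule.epsPow ((1 : ℕ) * p + q) (e i))) =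
      fun _ : Fin 1 => (-1 : K) ^ ((p + q) * r) • e 0 := by
    funext i
    rw [Fin.fin_one_eq_zero i, DGModule.epsPow_apply _ _ he, Nat.cast_one, one_mul]
    rfl
  have h2 : (fun i : {i : Fin 2 // i ≠ 1} =>
      φ (C.toDGModule.epsPow ((((1 : ℕ) : ℤ) - 1 - (i.1 : ℕ)) * p + q) (x i.1))) =
      fun _ => (-1 : K) ^ (q * s) • φ (x 0) := by
    funext i
    rw [Subsingleton.elim i default]
    change φ (C.toDGModule.epsPow ((((1 : ℕ) : ℤ) - 1 - ((0 : ℕ) : ℤ)) * p + q) (x 0)) = _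
    rw [DGModule.epsPow_apply _ _ hx, map_smul]
    simp
  rw [kappaTensor, LinearMap.comp_apply, TensorProduct.map_tmul,
    LinearMap.comp_apply (TensorProduct.map _ _), LinearEquiv.coe_coe, split_tprod,
    TensorProduct.map_tmul]
  simp only [LinearMap.comp_apply, PiTensorProduct.map_tprod]
  erw [h1, h2]
  change M.act 1 1 _ _ _ = _
  erw [← OpModule.binary_apply]
  change M.binary ((-1 : K) ^ ((p + q) * r) • e 0) ((-1 : K) ^ (q * s) • φ (x 0)) (g (x 1)) = _
  rw [map_smul, map_smul, LinearMap.smul_apply, LinearMap.smul_apply, LinearMap.smul_apply,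
    smul_comm, smul_smul, neg_one_zpow_add]

variable (C) in
theorem coprod_mem {p : ℤ} {c : C.toDGModule} (hc : c ∈ C.gr p) :
    C.coprod c ∈ mixedGr X C.toDGModule 1 2 p :=
  C.coact_mem 1 Tree.corolla p c hc

theorem kappaTensor_mem {p q : ℤ} {φ : C.toDGModule →ₗ[K] A.toDGModule}
    {g : C.toDGModule →ₗ[K] M.toDGModule} (hφ : φ ∈ DGModule.hom C.toDGModule A.toDGModule p)
    (hg : g ∈ DGModule.hom C.toDGModule M.toDGModule q) {n : ℤ}
    {z : (⨂[K]^1 X.E.susp.toDGModule) ⊗[K] (⨂[K]^2 C.toDGModule)}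
    (hz : z ∈ mixedGr X C.toDGModule 1 2 n) :
    kappaTensor C M p q φ g z ∈ M.gr (n + (p + q - 1)) := by
  refine mixedGr_le X C.toDGModule ((M.gr (n + (p + q - 1))).comap (kappaTensor C M p q φ g))
    (fun r e s x he hx hn => ?_) hz
  rw [Submodule.mem_comap, kappaTensor_tprod (he 0) (hx 0)]
  refine Submodule.smul_mem _ _ ?_
  -- The decoration has degree `r 0` in `sE` but `r 0 - 1` in `E`; this is the `-1` in the degree of
  -- the bracket.
  have h := M.binary_mem (he 0) (hφ _ _ (hx 0)) (hg _ _ (hx 1))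
  convert h using 2
  rw [← hn, Fin.sum_univ_one, Fin.sum_univ_two]
  ring

theorem kappaAction_mem {p q : ℤ} {φ : C.toDGModule →ₗ[K] A.toDGModule}
    {g : C.toDGModule →ₗ[K] M.toDGModule} (hφ : φ ∈ DGModule.hom C.toDGModule A.toDGModule p)
    (hg : g ∈ DGModule.hom C.toDGModule M.toDGModule q) :
    kappaAction C M p q φ g ∈ DGModule.hom C.toDGModule M.toDGModule (p + q - 1) := by
  intro n c hc
  rw [kappaAction_eq]
  exact kappaTensor_mem hφ hg (coprod_mem C hc)

/-- To prove an equation between maps `κ[φ, g]`, one may replace the coproduct of an element of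
`C` by homogeneous pure tensors. -/
theorem kappaAction_apply_congr {W : Type*} [AddCommGroup W] [Module K W]
    {f f' : (⨂[K]^1 X.E.susp.toDGModule) ⊗[K] (⨂[K]^2 C.toDGModule) →ₗ[K] W}
    (h : ∀ (r s s' : ℤ) (e : Fin 1 → X.E.susp.toDGModule) (x : Fin 2 → C.toDGModule),
      e 0 ∈ X.E.susp.gr r → x 0 ∈ C.gr s → x 1 ∈ C.gr s' →
        f (PiTensorProduct.tprod K e ⊗ₜ[K] PiTensorProduct.tprod K x) =
          f' (PiTensorProduct.tprod K e ⊗ₜ[K] PiTensorProduct.tprod K x)) :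
    f ∘ₗ C.coprod = f' ∘ₗ C.coprod := by
  refine DGModule.linearMap_ext fun n c hc => ?_
  exact eq_of_mem_mixedGr (coprod_mem C hc) fun r e s x he hx _ =>
    h (r 0) (s 0) (s 1) e x (he 0) (hx 0) (hx 1)

/-! ### Bilinearity of the action -/

theorem kappaAction_add_left (p q : ℤ) (φ φ' : C.toDGModule →ₗ[K] A.toDGModule)
    (g : C.toDGModule →ₗ[K] M.toDGModule) :
    kappaAction C M p q (φ + φ') g = kappaAction C M p q φ g + kappaAction C M p q φ' g := by
  simp only [kappaAction_eq, ← LinearMap.add_comp]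
  refine kappaAction_apply_congr fun r s s' e x he hx hx' => ?_
  simp [kappaTensor_tprod he hx]

theorem kappaAction_add_right (p q : ℤ) (φ : C.toDGModule →ₗ[K] A.toDGModule)
    (g g' : C.toDGModule →ₗ[K] M.toDGModule) :
    kappaAction C M p q φ (g + g') = kappaAction C M p q φ g + kappaAction C M p q φ g' := by
  simp only [kappaAction_eq, ← LinearMap.add_comp]
  refine kappaAction_apply_congr fun r s s' e x he hx hx' => ?_
  simp [kappaTensor_tprod he hx]

theorem kappaAction_smul_left (p q : ℤ) (c : K) (φ : C.toDGModule →ₗ[K] A.toDGModule)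
    (g : C.toDGModule →ₗ[K] M.toDGModule) :
    kappaAction C M p q (c • φ) g = c • kappaAction C M p q φ g := by
  simp only [kappaAction_eq, ← LinearMap.smul_comp]
  refine kappaAction_apply_congr fun r s s' e x he hx hx' => ?_
  simp [kappaTensor_tprod he hx, smul_comm c]

theorem kappaAction_smul_right (p q : ℤ) (c : K) (φ : C.toDGModule →ₗ[K] A.toDGModule)
    (g : C.toDGModule →ₗ[K] M.toDGModule) :
    kappaAction C M p q φ (c • g) = c • kappaAction C M p q φ g := by
  simp only [kappaAction_eq, ← LinearMap.smul_comp]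
  refine kappaAction_apply_congr fun r s s' e x he hx hx' => ?_
  simp [kappaTensor_tprod he hx, smul_comm c]

/-! ### Compatibility with the differentials -/

theorem mixedD_tprod {r s : ℤ} {e : Fin 1 → X.E.susp.toDGModule} {x : Fin 2 → C.toDGModule}
    (he : e 0 ∈ X.E.susp.gr r) {s' : ℤ} (hx : x 0 ∈ C.gr s) (hx' : x 1 ∈ C.gr s') :
    mixedD X C.toDGModule 1 2 (PiTensorProduct.tprod K e ⊗ₜ[K] PiTensorProduct.tprod K x) =
      -((PiTensorProduct.tprod K fun _ => X.E.d (e 0)) ⊗ₜ[K] PiTensorProduct.tprod K x) +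
      ((-1 : K) ^ r • (PiTensorProduct.tprod K e ⊗ₜ[K] PiTensorProduct.tprod K ![C.d (x 0), x 1]) +
        (-1 : K) ^ (r + s) •
          (PiTensorProduct.tprod K e ⊗ₜ[K] PiTensorProduct.tprod K ![x 0, C.d (x 1)])) := by
  have he' : ∀ i, e i ∈ X.E.susp.gr r := fun i => by rwa [Fin.fin_one_eq_zero i]
  have hx'' : ∀ i, x i ∈ C.gr (![s, s'] i) := by
    intro i
    fin_cases i
    exacts [hx, hx']
  have h0 : ({j | j < 1} : Finset (Fin 2)) = {0} := by decide
  -- The minus sign comes from `d (s x) = - s (d x)`.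
  have h1 : Function.update e 0 (X.E.susp.d (e 0)) = -fun _ : Fin 1 => X.E.d (e 0) := by
    funext i
    rw [Fin.fin_one_eq_zero i, Function.update_self]
    rfl
  have h2 : PiTensorProduct.tprod K (-fun _ : Fin 1 => X.E.d (e 0)) =
      -PiTensorProduct.tprod K (fun _ : Fin 1 => X.E.d (e 0)) := by
    have := (PiTensorProduct.tprod K (s := fun _ : Fin 1 => X.E.carrier)).map_smul_univ
      (fun _ => -1) (fun _ : Fin 1 => X.E.d (e 0))
    simp only [neg_smul, one_smul, Finset.prod_const, Finset.card_univ, Fintype.card_fin,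
      pow_one] at this
    exact this
  have h3 : Function.update x 0 (C.d (x 0)) = ![C.d (x 0), x 1] := by
    funext i
    fin_cases i <;> simp
  have h4 : Function.update x 1 (C.d (x 1)) = ![x 0, C.d (x 1)] := by
    funext i
    fin_cases i <;> simp
  rw [mixedD, LinearMap.add_apply, TensorProduct.map_tmul, TensorProduct.map_tmul,
    DGModule.tensD_tprod _ _ _ he', DGModule.tensEps_tprod _ _ _ he',
    DGModule.tensD_tprod _ _ _ hx'', Fin.sum_univ_one, Fin.sum_univ_one, Fin.sum_univ_two, h3, h4,
    h0, h1]
  erw [h2]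
  simp [neg_one_zpow_add, TensorProduct.tmul_add, TensorProduct.smul_tmul', smul_smul,
    TensorProduct.neg_tmul, mul_comm]

/-- Both minus signs arise because the outer differential passes `κ`, of degree `-1`. The terms in
which the decoration is differentiated cancel, since `κ` anticommutes with the internal
differentials. -/
theorem kappaAction_homD {p q : ℤ} {φ : C.toDGModule →ₗ[K] A.toDGModule}
    {g : C.toDGModule →ₗ[K] M.toDGModule} (hφ : φ ∈ DGModule.hom C.toDGModule A.toDGModule p)
    (hg : g ∈ DGModule.hom C.toDGModule M.toDGModule q) :
    DGModule.homD C.toDGModule M.toDGModule (p + q - 1) (kappaAction C M p q φ g) =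
      -kappaAction C M (p - 1) q (DGModule.homD C.toDGModule A.toDGModule p φ) g -
        (-1 : K) ^ p •
          kappaAction C M p (q - 1) φ (DGModule.homD C.toDGModule M.toDGModule q g) := by
  have hd : C.coprod ∘ₗ C.d = mixedD X C.toDGModule 1 2 ∘ₗ C.coprod :=
    LinearMap.ext fun c => C.coact_d 1 Tree.corolla c
  simp only [kappaAction_eq, DGModule.homD]
  rw [LinearMap.comp_assoc, hd]
  simp only [← LinearMap.comp_assoc, ← LinearMap.smul_comp, ← LinearMap.sub_comp,
    ← LinearMap.neg_comp]
  refine kappaAction_apply_congr fun r s s' e x he hx hx' => ?_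
  -- `sE` and `E` have the same underlying space with degrees shifted by one; the Leibniz rule in
  -- `M` needs the degree in `E`.
  have he' : e 0 ∈ X.E.gr (r - 1) := he
  have hde : X.E.d (e 0) ∈ X.E.susp.gr (r - 1) := X.E.d_mem _ _ he'
  simp only [LinearMap.sub_apply, LinearMap.comp_apply, LinearMap.smul_apply, LinearMap.neg_apply,
    mixedD_tprod he hx hx', map_add, map_neg, map_smul]
  rw [kappaTensor_tprod he hx, kappaTensor_tprod he hx, kappaTensor_tprod he hx,
    kappaTensor_tprod (x := x) hde hx,
    kappaTensor_tprod (x := ![C.d (x 0), x 1]) he (C.d_mem _ _ hx),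
    kappaTensor_tprod (x := ![x 0, C.d (x 1)]) he hx, map_smul,
    M.d_binary he' (hφ _ _ hx) (hg _ _ hx')]
  simp only [LinearMap.sub_apply, LinearMap.comp_apply, LinearMap.smul_apply, map_sub, map_smul,
    Matrix.cons_val_zero, Matrix.cons_val_one, smul_sub, smul_add, smul_smul,
    ← neg_one_zpow_add]
  match_scalars <;> simp only [mul_one, sub_eq_zero, neg_neg_one_zpow] <;>
    refine neg_one_zpow_congr ?_ <;> push_cast <;> grind

/-! ### Symmetry of the bracket -/

theorem selfModule_binary {A : OpAlgebra.{u, v, w'} X} (e : X.E.toDGModule)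
    (x : Fin 2 → A.toDGModule) :
    A.selfModule.binary e (x 0) (x 1) =
      A.act 1 (X.E.tree X.rels Tree.corolla (PiTensorProduct.tprod K fun _ => e))
        (PiTensorProduct.tprod K x) := by
  rw [OpModule.binary_apply]
  change A.act 1 _ ((split K A.toDGModule 1).symm (_ ⊗ₜ[K] x 1)) = _
  rw [split_symm_tmul (K := K) _ (1 : Fin 2) (fun _ => x 0)]
  congr 2
  funext i
  fin_cases i <;> simp

/-- Relabelling the inputs of the corolla is the same as exchanging its branches, and hence as
letting `𝕊₂` act on the decoration; equivariance of the algebra does the rest. -/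
theorem binary_swap {A : OpAlgebra.{u, v, w'} X} {i j : ℤ} (e : X.E.toDGModule)
    {a b : A.toDGModule} (ha : a ∈ A.gr i) (hb : b ∈ A.gr j) :
    A.selfModule.binary (X.E.swap e) a b = (-1 : K) ^ (i * j) • A.selfModule.binary e b a := by
  have hx : ∀ l, ![a, b] l ∈ A.gr (![i, j] l) := by
    intro l
    fin_cases l
    exacts [ha, hb]
  have h1 : X.E.perm X.rels (Equiv.swap 0 1)
      (X.E.tree X.rels Tree.corolla (PiTensorProduct.tprod K fun _ => e)) =
      X.E.tree X.rels Tree.corolla (PiTensorProduct.tprod K fun _ => X.E.swap e) := by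
    rw [Generators.perm_tree]
    rw [← X.E.tree_swapAt X.rels (t := Tree.corolla.relabel (Equiv.swap 0 1) 1)
      (t' := Tree.corolla) (y := 0) rfl]
    congr 1
    rw [Generators.swapFactor, PiTensorProduct.map_tprod]
    refine congrArg (PiTensorProduct.tprod K (s := fun _ : Fin 1 => X.E.carrier))
      (funext fun l => ?_)
    rw [Fin.fin_one_eq_zero l, if_pos rfl]
  have h := A.act_perm 1 (Equiv.swap 0 1)
    (X.E.tree X.rels Tree.corolla (PiTensorProduct.tprod K fun _ => e)) _ _ hx
  rw [h1, ← selfModule_binary, koszulSign_swap_two (fun l => ![i, j] (Equiv.swap 0 1 l)),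
    ← selfModule_binary e (fun l => ![a, b] (Equiv.swap 0 1 l))] at h
  simpa [mul_comm] using h

/-- The coproduct is invariant when `𝕊₂` acts on decoration and factors together. The signs from
exchanging `x₀, x₁` and from exchanging their images under `ψ, φ` combine to `(-1)^(p q)` once the
Koszul signs of the maps are included. -/
theorem kappaBracket_swap [CharZero K] (A : OpAlgebra.{u, v, w'} X) {p q : ℤ}
    {φ ψ : C.toDGModule →ₗ[K] A.toDGModule}
    (hφ : φ ∈ DGModule.hom C.toDGModule A.toDGModule p)
    (hψ : ψ ∈ DGModule.hom C.toDGModule A.toDGModule q) :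
    kappaBracket C A p q φ ψ = (-1 : K) ^ (p * q) • kappaBracket C A q p ψ φ := by
  have hs : TensorProduct.map (X.E.susp.swapFactor 0) LinearMap.id ∘ₗ C.coprod =
      TensorProduct.map LinearMap.id (C.toDGModule.koszul (Equiv.swap 0 1)) ∘ₗ C.coprod := by
    refine LinearMap.ext fun c => ?_
    have h := C.coact_perm 1 Tree.corolla (Equiv.swap 0 1) c
    rwa [evalTree_swapAt (t := Tree.corolla) (y := 0) rfl] at h
  -- The equation `hs` matches the swap of the decoration with the swap of the factors; as the
  -- former is an involution, applying it once more gives invariance under both together.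
  have hc : C.coprod = TensorProduct.map (X.E.susp.swapFactor 0)
      (C.toDGModule.koszul (Equiv.swap 0 1)) ∘ₗ C.coprod := by
    have h2 : X.E.susp.swapFactor (0 : Fin 1) ∘ₗ X.E.susp.swapFactor 0 = LinearMap.id := by
      refine PiTensorProduct.ext (MultilinearMap.ext fun x => ?_)
      simp only [Generators.swapFactor, LinearMap.compMultilinearMap_apply, LinearMap.comp_apply,
        PiTensorProduct.map_tprod, LinearMap.id_apply]
      congr 1
      funext l
      rw [Fin.fin_one_eq_zero l, if_pos rfl]
      exact X.E.swap_swap _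
    have h3 := congrArg (TensorProduct.map (X.E.susp.swapFactor (0 : Fin 1))
      (LinearMap.id : (⨂[K]^2 C.toDGModule) →ₗ[K] _) ∘ₗ ·) hs
    simp only [← LinearMap.comp_assoc, ← TensorProduct.map_comp, h2, LinearMap.id_comp,
      LinearMap.comp_id, TensorProduct.map_id] at h3
    exact h3
  rw [kappaBracket_eq_kappaAction, kappaBracket_eq_kappaAction, kappaAction_eq, kappaAction_eq,
    ← LinearMap.smul_comp]
  conv_lhs => rw [hc, ← LinearMap.comp_assoc]
  refine kappaAction_apply_congr fun r s s' e x he hx hx' => ?_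
  have hx'' : ∀ l, x l ∈ C.gr (![s, s'] l) := by
    intro l
    fin_cases l
    exacts [hx, hx']
  rw [LinearMap.comp_apply, TensorProduct.map_tmul, DGModule.koszul_tprod _ _ _ _ hx'',
    Generators.swapFactor, PiTensorProduct.map_tprod]
  erw [koszulSign_swap_two]
  rw [TensorProduct.tmul_smul, map_smul, kappaTensor_tprod (r := r) (s := s') _ hx']
  · erw [binary_swap (e 0) (hφ _ _ hx') (hψ _ _ hx)]
    rw [LinearMap.smul_apply, kappaTensor_tprod he hx]
    simp only [smul_smul, ← neg_one_zpow_add]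
    congr 1
    refine neg_one_zpow_congr ?_
    simp
    grind
  · exact X.E.susp.swap_mem _ _ he

end KappaAction

/-! ## Compositions of two generators -/

/-- The tree `(0 (1 2))`, the vertex at the root being labelled `0`. -/
def Tree.rightComb : Tree 2 := Tree.corolla.graft 1 Tree.corolla

/-- Relates the comb from the definition of `d₂` to the tree which arises by grafting at the last
leaf, as in `κ[φ, κ[ψ, g]]`. -/
theorem Tree.comb_one : (Tree.comb 1).1 = Tree.rightComb.1.swapAt 0 := rfl

/-- This is why the third summand of `d₂` is the second one with `φ` and `ψ` exchanged. -/
theorem Tree.comb_two :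
    (Tree.comb 2).1 = ((Tree.comb 1).relabel (Equiv.swap 0 1) 1).1.swapAt 1 := rfl

theorem mulEquiv_tprod (V : Type v) [AddCommGroup V] [Module K V] {m n : ℕ} (a : Fin m → V)
    (b : Fin n → V) :
    TensorPower.mulEquiv (R := K) (M := V)
        (PiTensorProduct.tprod K a ⊗ₜ[K] PiTensorProduct.tprod K b) =
      PiTensorProduct.tprod K (Fin.append a b) := by
  have h := TensorPower.tprod_mul_tprod K a b
  rwa [TensorPower.gMul_def] at h

namespace OpModule

variable {X : QuadraticData.{u, v} K} {A : OpAlgebra.{u, v, w} X} (M : OpModule.{u, v, w, w'} A)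

/-- The ternary operation of a module which is given by an element of the operad. -/
def ternary (μ : X.Op 2) (a b : A.toDGModule) (m : M.toDGModule) : M.toDGModule :=
  M.act 2 2 μ (PiTensorProduct.tprod K fun i => ![a, b, 0] i.1) m

/-- No sign: nothing stands to the left of the inserted operation. -/
theorem ternary_comb_zero {i j k l : ℤ} {e e' : X.E.toDGModule} {a b : A.toDGModule}
    {m : M.toDGModule} (he' : e' ∈ X.E.gr i) (ha : a ∈ A.gr j) (hb : b ∈ A.gr k)
    (hm : m ∈ M.gr l) :
    M.ternary (X.E.tree X.rels (Tree.comb 0) (PiTensorProduct.tprod K ![e, e'])) a b m =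
      M.binary e (A.selfModule.binary e' a b) m := by
  -- Plugging into input 0 moves input 1, which carries the module element, to place 2. The third
  -- entry of `![a, b, 0]` is a dummy for that place.
  have h := M.act_comp_outer 1 1 0 1 i
    (X.E.tree X.rels Tree.corolla (PiTensorProduct.tprod K fun _ => e))
    (X.E.tree X.rels Tree.corolla (PiTensorProduct.tprod K fun _ => e')) ![j, k, l] ![a, b, 0] m
    (by decide) (corolla_mem he') (by
      intro q hq
      fin_cases q
      exacts [ha, hb, (hq rfl).elim]) hm
  rw [Generators.comp_tree, mulEquiv_tprod] at h
  have h1 : Fin.append (fun _ : Fin 1 => e) (fun _ : Fin 1 => e') = ![e, e'] := by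
    funext q
    fin_cases q <;> rfl
  rw [h1] at h
  refine Eq.trans h ?_
  have h0 : ({j | j < 0} : Finset (Fin 2)) = ∅ := by decide
  simp only [Nat.reduceAdd, h0, Finset.sum_empty, mul_zero, zpow_zero, one_smul]
  rw [binary_apply]
  refine congrArg (fun f => M.act 1 1 _ (PiTensorProduct.tprod K f) m) (funext fun q => ?_)
  rw [Subsingleton.elim q default]
  refine (if_pos (show (default : {q : Fin 2 // q ≠ 1}).1 = 0 from rfl)).trans ?_
  refine Eq.trans ?_ (selfModule_binary e' ![a, b]).symm
  refine congrArg (fun f => A.act 1 _ (PiTensorProduct.tprod K f)) (funext fun q => ?_)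
  fin_cases q <;> rfl

/-- The sign records `e'`, of degree `i` in `E`, passing `a`. -/
theorem ternary_rightComb {i j k l : ℤ} {e e' : X.E.toDGModule} {a b : A.toDGModule}
    {m : M.toDGModule} (he' : e' ∈ X.E.gr i) (ha : a ∈ A.gr j) (hb : b ∈ A.gr k)
    (hm : m ∈ M.gr l) :
    M.ternary (X.E.tree X.rels Tree.rightComb (PiTensorProduct.tprod K ![e, e'])) a b m =
      (-1 : K) ^ (i * j) • M.binary e a (M.binary e' b m) := by
  have h := M.act_comp_inner 1 1 1 1 i
    (X.E.tree X.rels Tree.corolla (PiTensorProduct.tprod K fun _ => e))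
    (X.E.tree X.rels Tree.corolla (PiTensorProduct.tprod K fun _ => e')) ![j, k, l] ![a, b, 0] m
    (corolla_mem he') (by
      intro q hq
      fin_cases q
      exacts [ha, hb, (hq rfl).elim]) hm
  rw [Generators.comp_tree, mulEquiv_tprod] at h
  have h1 : Fin.append (fun _ : Fin 1 => e) (fun _ : Fin 1 => e') = ![e, e'] := by
    funext q
    fin_cases q <;> rfl
  rw [h1] at h
  refine Eq.trans h ?_
  have h0 : ({j | j < 1} : Finset (Fin 2)) = {0} := by decide
  simp only [Nat.reduceAdd, h0, Finset.sum_singleton]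
  rw [binary_apply, binary_apply]
  have h2 : (fun q : {q : Fin 2 // q ≠ 1} => ![a, b, 0] (outerPlace 1 1 q.1)) = fun _ => a := by
    funext q
    rw [Subsingleton.elim q default]
    rfl
  have h3 : (fun q : {q : Fin 2 // q ≠ 1} => ![a, b, 0] (innerPlace 1 q.1)) = fun _ => b := by
    funext q
    rw [Subsingleton.elim q default]
    rfl
  exact congrArg₂ (fun f f' => (-1 : K) ^ (i * j) • M.act 1 1 _ (PiTensorProduct.tprod K f)
    (M.act 1 1 _ (PiTensorProduct.tprod K f') m)) h2 h3

theorem ternary_perm {j k l : ℤ} (μ : X.Op 2) {a b : A.toDGModule}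
    {m : M.toDGModule} (ha : a ∈ A.gr j) (hb : b ∈ A.gr k) (hm : m ∈ M.gr l) :
    M.ternary (X.E.perm X.rels (Equiv.swap 0 1) μ) a b m =
      (-1 : K) ^ (j * k) • M.ternary μ b a m := by
  have h := M.act_perm 2 2 (Equiv.swap 0 1) μ ![j, k, l] ![a, b, 0] m (by
      intro q hq
      fin_cases q
      exacts [ha, hb, (hq rfl).elim]) hm
  refine Eq.trans h ?_
  rw [koszulSign_swap_three (fun l' => ![j, k, l] (Equiv.swap 0 1 l'))]
  rw [mul_comm j k]
  refine congrArg (fun f => (-1 : K) ^ (k * j) • M.act 2 2 μ (PiTensorProduct.tprod K f) m)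
    (funext fun q => ?_)
  obtain ⟨q, hq⟩ := q
  fin_cases q
  exacts [rfl, rfl, (hq rfl).elim]

end OpModule

/-! ## Insertion of the coproduct -/

section Insert

variable {X : QuadraticData.{u, v} K} {V : DGModule.{u, w} K}

/-- The tensors which arise from `x₀ ⊗ ⋯ ⊗ xₖ` when a value of
`f : V → (sE)^{⊗ l} ⊗ V^{⊗ (l + 1)}` is inserted in place `i`. -/
def insertAt {k : ℕ} (l : ℕ) (i : Fin (k + 1)) (x : Fin (k + 1) → V) :
    (⨂[K]^l X.E.susp.toDGModule) ⊗[K] (⨂[K]^(l + 1) V) →ₗ[K]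
      (⨂[K]^l X.E.susp.toDGModule) ⊗[K] (⨂[K]^(k + l + 1) V) :=
  TensorProduct.map LinearMap.id (merge K V l i).toLinearMap ∘ₗ
    (TensorProduct.leftComm K (⨂[K] _ : {j : Fin (k + 1) // j ≠ i}, V)
      (⨂[K]^l X.E.susp.toDGModule) (⨂[K]^(l + 1) V)).toLinearMap ∘ₗ
    (∑ b : Bool, TensorProduct.map
      (PiTensorProduct.map fun j => if j.1 < i ∧ b = true then V.eps else LinearMap.id)
      (TensorProduct.map
        ((2⁻¹ : K) • (if b then LinearMap.id - X.E.susp.toDGModule.tensEps l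
          else LinearMap.id + X.E.susp.toDGModule.tensEps l))
        LinearMap.id)) ∘ₗ
    TensorProduct.mk K _ _ (PiTensorProduct.tprod K fun j : {j : Fin (k + 1) // j ≠ i} => x j.1)

theorem applyAt_tprod {k : ℕ} (l : ℕ) (i : Fin (k + 1)) (x : Fin (k + 1) → V)
    (f : V →ₗ[K] (⨂[K]^l X.E.susp.toDGModule) ⊗[K] (⨂[K]^(l + 1) V)) :
    applyAt X V l i f (PiTensorProduct.tprod K x) = insertAt l i x (f (x i)) := by
  simp only [applyAt, insertAt, LinearMap.comp_apply, LinearEquiv.coe_coe, split_tprod,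
    TensorProduct.map_tmul, TensorProduct.mk_apply, LinearMap.id_apply]

/-- The new decorations, of total degree `∑ j, r j`, are moved to the front past the factors to the
left of place `i`. -/
theorem insertAt_tprod [CharZero K] {k l : ℕ} (i : Fin (k + 1)) {x : Fin (k + 1) → V}
    {s : Fin (k + 1) → ℤ} (hx : ∀ j, x j ∈ V.gr (s j)) {r : Fin l → ℤ}
    {e : Fin l → X.E.susp.toDGModule} (he : ∀ j, e j ∈ X.E.susp.gr (r j)) (y : Fin (l + 1) → V) :
    insertAt l i x (PiTensorProduct.tprod K e ⊗ₜ[K] PiTensorProduct.tprod K y) =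
      (-1 : K) ^ ((∑ j, r j) * ∑ j with j < i, s j) •
        (PiTensorProduct.tprod K e ⊗ₜ[K] PiTensorProduct.tprod K fun q =>
          Sum.elim (fun j : {j : Fin (k + 1) // j ≠ i} => x j.1) y ((placeEquiv l i).symm q)) := by
  have h2 (z : ⨂[K]^l X.E.susp.toDGModule) : (2⁻¹ : K) • z + (2⁻¹ : K) • z = z := by
    rw [← smul_add, ← two_smul K, smul_smul, inv_mul_cancel₀ two_ne_zero, one_smul]
  have hT := X.E.susp.tensEps_tprod r e he
  simp only [insertAt, LinearMap.comp_apply, TensorProduct.mk_apply,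
    TensorProduct.map_tmul, Fintype.sum_bool, LinearMap.smul_apply, if_true,
    LinearMap.sub_apply, LinearMap.id_apply, LinearMap.add_apply, hT, Bool.false_eq_true, if_false,
    and_true, and_false, PiTensorProduct.map_tprod]
  -- The sum over `b` splits the decorations by parity: in even degree only `b = false` contributes,
  -- in odd degree only `b = true`, which applies the sign operator to the factors on the left.
  rcases Int.even_or_odd (∑ j, r j) with h | h
  · rw [(h.mul_right _).neg_one_zpow, h.neg_one_zpow]
    simp only [one_smul, sub_self, smul_zero, TensorProduct.zero_tmul, TensorProduct.tmul_zero,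
      zero_add, smul_add, h2, LinearEquiv.coe_coe, TensorProduct.leftComm_tmul,
      TensorProduct.map_tmul, LinearMap.id_apply, merge_tmul]
  · have h3 : (-1 : K) ^ ((∑ j, r j) * ∑ j with j < i, s j) = (-1) ^ (∑ j with j < i, s j) := by
      rw [zpow_mul_eq_zpow_ite, if_neg (Int.not_even_iff_odd.2 h)]
    have h4 : (PiTensorProduct.tprod K fun j : {j : Fin (k + 1) // j ≠ i} =>
        (if j.1 < i then V.eps else LinearMap.id) (x j.1)) =
        (-1 : K) ^ (∑ j with j < i, s j) • PiTensorProduct.tprod K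
          fun j : {j : Fin (k + 1) // j ≠ i} => x j.1 := by
      -- Omitting the place `i` from the product is harmless, as its factor is 1.
      have h5 : (-1 : K) ^ (∑ j with j < i, s j) =
          ∏ j : {j : Fin (k + 1) // j ≠ i}, if j.1 < i then (-1 : K) ^ s j.1 else 1 := by
        rw [neg_one_zpow_sum, Finset.prod_filter, ← (pointEquiv i).prod_comp,
          Fintype.prod_sum_type]
        change (∏ a : {j : Fin (k + 1) // j ≠ i}, if a.1 < i then (-1 : K) ^ s a.1 else 1) *
          (∏ _ : Unit, if i < i then (-1 : K) ^ s i else 1) = _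
        simp
      rw [h5, ← MultilinearMap.map_smul_univ]
      congr 1
      funext j
      split_ifs
      · exact V.eps_apply (hx _)
      · simp
    rw [h3, h.neg_one_zpow, h4]
    simp only [neg_smul, one_smul, sub_neg_eq_add, add_neg_cancel, smul_zero,
      TensorProduct.zero_tmul, TensorProduct.tmul_zero, add_zero, smul_add, h2, LinearEquiv.coe_coe,
      TensorProduct.leftComm_tmul, ← TensorProduct.smul_tmul', map_smul,
      TensorProduct.map_tmul, LinearMap.id_apply, merge_tmul]

end Insert

/-! ## Trees with two vertices -/

section TreeTensor

variable (X : QuadraticData.{u, v} K)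

/-- The composite in the operad of two suspended generators along a tree with two vertices. -/
def QuadraticData.composeAlong (t : Tree 2) : (⨂[K]^2 X.E.susp.toDGModule) →ₗ[K] X.Op 2 :=
  X.E.tree X.rels t ∘ₗ PiTensorProduct.map fun j =>
    (if j = 0 then X.E.toDGModule.eps else LinearMap.id) ∘ₗ X.E.desusp

theorem QuadraticData.composeAlong_tprod (t : Tree 2) {e : Fin 2 → X.E.susp.toDGModule} {r : ℤ}
    (he : e 0 ∈ X.E.susp.gr r) :
    X.composeAlong t (PiTensorProduct.tprod K e) =
      (-1 : K) ^ (r - 1) • X.E.tree X.rels t (PiTensorProduct.tprod K (s := fun _ => X.E.carrier)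
        ![e 0, e 1]) := by
  have h : (fun j => ((if j = 0 then X.E.toDGModule.eps else LinearMap.id) ∘ₗ X.E.desusp) (e j)) =
      fun j : Fin 2 => (![(-1 : K) ^ (r - 1), 1] j) • (![e 0, e 1] : Fin 2 → X.E.carrier) j := by
    funext j
    fin_cases j
    · exact X.E.toDGModule.eps_apply (p := r - 1) he
    · exact (one_smul K _).symm
  rw [composeAlong, LinearMap.comp_apply, PiTensorProduct.map_tprod, h,
    MultilinearMap.map_smul_univ, map_smul]
  simp

/-- The action of `𝕊₂` preserves degrees, so it commutes with the sign in the composition of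
suspended generators. -/
theorem QuadraticData.composeAlong_swapAt {t t' : Tree 2} {y : Fin 2} (h : t'.1 = t.1.swapAt y) :
    X.composeAlong t' ∘ₗ X.E.susp.swapFactor y = X.composeAlong t := by
  have hswap : X.E.toDGModule.eps ∘ₗ X.E.swap = X.E.swap ∘ₗ X.E.toDGModule.eps := by
    refine DGModule.linearMap_ext fun p x hx => ?_
    rw [LinearMap.comp_apply, LinearMap.comp_apply, X.E.toDGModule.eps_apply hx,
      X.E.toDGModule.eps_apply (X.E.swap_mem _ _ hx), map_smul]
  refine PiTensorProduct.ext (MultilinearMap.ext fun e => ?_)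
  simp only [LinearMap.compMultilinearMap_apply, composeAlong, LinearMap.comp_apply]
  rw [← X.E.tree_swapAt X.rels h]
  congr 1
  simp only [Generators.swapFactor, PiTensorProduct.map_tprod]
  congr 1
  funext j
  split_ifs
  · exact LinearMap.congr_fun hswap _
  · rfl
  · rfl
  · rfl

/-- The elements of the Koszul dual cooperad are orthogonal to the relations. -/
theorem QuadraticData.sum_composeAlong_eq_zero (x : X.coop 2) :
    ∑ u, X.composeAlong (Tree.comb u) (x.1 (Tree.comb u)) = 0 := by
  -- With two vertices the condition defining the kernel of `d₂` is needed only for the three combs,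
  -- whose subtrees are the leaves 0, 1, 2.
  have hs : SameContraction 0 1 (fun u => (Tree.comb u).1) := by
    convert SameContraction.root (v := (0 : Fin 2)) (w := 1) (.leaf (0 : Fin 3)) (.leaf 1)
      (.leaf 2) using 1
    funext u
    fin_cases u <;> rfl
  have h := x.2.2 Tree.comb hs
  -- No vertices remain after the contraction, so the leftover tensor power is the ground field.
  have hc (u : Fin 3) : (TensorProduct.rid K (X.Op 2)).toLinearMap ∘ₗ TensorProduct.map LinearMap.id
      (PiTensorProduct.isEmptyEquiv (R := K) (Fin 0)).toLinearMap ∘ₗ X.contract 0 u =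
      X.composeAlong (Tree.comb u) := by
    refine PiTensorProduct.ext (MultilinearMap.ext fun e => ?_)
    simp only [LinearMap.compMultilinearMap_apply, contract, LinearMap.comp_apply,
      LinearEquiv.coe_coe]
    erw [PiTensorProduct.reindex_tprod, PiTensorProduct.tmulEquiv_symm_apply]
    rw [TensorProduct.map_tmul, TensorProduct.map_tmul]
    erw [PiTensorProduct.isEmptyEquiv_apply_tprod, TensorProduct.rid_tmul]
    rw [one_smul]
    refine congrArg (fun f => X.composeAlong (Tree.comb u) (PiTensorProduct.tprod K f))
      (funext fun j => ?_)
    fin_cases j <;> rfl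
  have h' := congrArg ((TensorProduct.rid K (X.Op 2)).toLinearMap ∘ₗ TensorProduct.map LinearMap.id
      (PiTensorProduct.isEmptyEquiv (R := K) (Fin 0)).toLinearMap) h
  rw [map_sum, map_zero] at h'
  rw [← h']
  exact Finset.sum_congr rfl fun u _ => (LinearMap.congr_fun (hc u) _).symm

/-! ### Operations of trees on three maps -/

variable {X} (C : OpCoalgebra.{u, v, w} X) {A : OpAlgebra.{u, v, w'} X}
  (M : OpModule.{u, v, w', w''} A)

/-- The operation of an element of the operad on `φ`, `ψ` and `g`. -/
def ternaryTensor (p q r : ℤ) (φ ψ : C.toDGModule →ₗ[K] A.toDGModule)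
    (g : C.toDGModule →ₗ[K] M.toDGModule) :
    X.Op 2 →ₗ[K] (⨂[K]^3 C.toDGModule) →ₗ[K] M.toDGModule :=
  LinearMap.lcomp K M.toDGModule (TensorProduct.map
      (PiTensorProduct.map fun i : {i : Fin 3 // i ≠ 2} =>
        if i.1 = 0 then φ ∘ₗ C.epsPow p else ψ ∘ₗ C.epsPow (p + q))
      (g ∘ₗ C.epsPow (p + q + r)) ∘ₗ (split K C.toDGModule (2 : Fin 3)).toLinearMap) ∘ₗ
    (TensorProduct.lift.equiv (RingHom.id K) _ _ _).toLinearMap ∘ₗ M.act 2 2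

/-- The operation of the tree `t` with vertices decorated by suspended generators on `φ`, `ψ`
and `g`. -/
def treeTensor (p q r : ℤ) (φ ψ : C.toDGModule →ₗ[K] A.toDGModule)
    (g : C.toDGModule →ₗ[K] M.toDGModule) (t : Tree 2) :
    (⨂[K]^2 X.E.susp.toDGModule) ⊗[K] (⨂[K]^3 C.toDGModule) →ₗ[K] M.toDGModule :=
  TensorProduct.lift (ternaryTensor C M p q r φ ψ g ∘ₗ X.composeAlong t)

variable {C M} {p q r : ℤ} {φ ψ : C.toDGModule →ₗ[K] A.toDGModule}
  {g : C.toDGModule →ₗ[K] M.toDGModule}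

/-- The sign is the Koszul sign for maps written on the right: `φ` passes `x₀, x₁, x₂`, then `ψ`
passes `x₁, x₂` and `g` passes `x₂`. It differs from the usual one by `(-1)^((p+q+r)(s₀+s₁+s₂))`. In
this form the degrees of the decorations do not enter; they return through the total degree `n` in
the factor `(-1)^((p+q+r) n)` below. -/
theorem ternaryTensor_tprod (μ : X.Op 2) {s : Fin 3 → ℤ} {x : Fin 3 → C.toDGModule}
    (hx : ∀ i, x i ∈ C.gr (s i)) :
    ternaryTensor C M p q r φ ψ g μ (PiTensorProduct.tprod K x) =
      (-1 : K) ^ (p * s 0 + (p + q) * s 1 + (p + q + r) * s 2) •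
        M.ternary μ (φ (x 0)) (ψ (x 1)) (g (x 2)) := by
  have h : (fun i : {i : Fin 3 // i ≠ 2} =>
      (if i.1 = 0 then φ ∘ₗ C.epsPow p else ψ ∘ₗ C.epsPow (p + q)) (x i.1)) =
      fun i => (![(-1 : K) ^ (p * s 0), (-1 : K) ^ ((p + q) * s 1), 1] i.1) •
        (![φ (x 0), ψ (x 1), 0] i.1) := by
    funext i
    obtain ⟨i, hi⟩ := i
    fin_cases i
    · change φ (C.epsPow p (x 0)) = _
      rw [DGModule.epsPow_apply _ _ (hx 0), map_smul]
      rfl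
    · change ψ (C.epsPow (p + q) (x 1)) = _
      rw [DGModule.epsPow_apply _ _ (hx 1), map_smul]
      rfl
    · exact (hi rfl).elim
  have hprod : (∏ i : {i : Fin 3 // i ≠ 2},
      ![(-1 : K) ^ (p * s 0), (-1 : K) ^ ((p + q) * s 1), 1] i.1) =
      (-1 : K) ^ (p * s 0) * (-1 : K) ^ ((p + q) * s 1) := by
    rw [← Finset.prod_subtype {0, 1} (by decide)
      ![(-1 : K) ^ (p * s 0), (-1 : K) ^ ((p + q) * s 1), 1]]
    simp
  simp only [ternaryTensor, LinearMap.comp_apply, LinearMap.lcomp_apply, LinearEquiv.coe_coe,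
    split_tprod, TensorProduct.map_tmul, PiTensorProduct.map_tprod, h]
  rw [DGModule.epsPow_apply _ _ (hx 2), MultilinearMap.map_smul_univ, hprod, map_smul]
  simp only [TensorProduct.tmul_smul, ← TensorProduct.smul_tmul', map_smul, smul_smul]
  rw [neg_one_zpow_add, neg_one_zpow_add, mul_comm]
  rfl

theorem treeTensor_tprod (t : Tree 2) {r₀ : ℤ} {e : Fin 2 → X.E.susp.toDGModule}
    (he : e 0 ∈ X.E.susp.gr r₀) {s : Fin 3 → ℤ} {x : Fin 3 → C.toDGModule}
    (hx : ∀ i, x i ∈ C.gr (s i)) :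
    treeTensor C M p q r φ ψ g t (PiTensorProduct.tprod K e ⊗ₜ[K] PiTensorProduct.tprod K x) =
      (-1 : K) ^ (r₀ - 1 + (p * s 0 + (p + q) * s 1 + (p + q + r) * s 2)) •
        M.ternary (X.E.tree X.rels t (PiTensorProduct.tprod K (s := fun _ => X.E.carrier)
          ![e 0, e 1])) (φ (x 0)) (ψ (x 1)) (g (x 2)) := by
  rw [treeTensor, TensorProduct.lift.tmul, LinearMap.comp_apply, X.composeAlong_tprod t he,
    map_smul, LinearMap.smul_apply, ternaryTensor_tprod _ hx, smul_smul, neg_one_zpow_add (r₀ - 1)]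

theorem treeTensor_swapAt {t t' : Tree 2} {y : Fin 2} (h : t'.1 = t.1.swapAt y)
    (c : C.toDGModule) :
    treeTensor C M p q r φ ψ g t' (evalTree X C.toDGModule t' (C.coact c)) =
      treeTensor C M p q r φ ψ g t (evalTree X C.toDGModule t (C.coact c)) := by
  rw [evalTree_swapAt h, treeTensor, treeTensor, ← X.composeAlong_swapAt h]
  generalize evalTree X C.toDGModule t (C.coact c) = z
  induction z with
  | zero => simp only [map_zero]
  | add a b ha hb => simp only [map_add, ha, hb]
  | tmul x y => rfl

/-- The relation in the kernel of `d₂`, transported along the coaction: summed over the three combs,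
the operations act through an element of `P(3)` which is zero. -/
theorem sum_treeTensor_comb (c : C.toDGModule) :
    ∑ u, treeTensor C M p q r φ ψ g (Tree.comb u)
      (evalTree X C.toDGModule (Tree.comb u) (C.coact c)) = 0 := by
  simp only [evalTree, LinearMap.comp_apply]
  generalize DirectSum.component K ℕ (fun k => X.coop k ⊗[K] (⨂[K]^(k + 1) C.toDGModule)) 2
    (C.coact c) = z
  induction z with
  | zero => simp only [map_zero, Finset.sum_const_zero]
  | add a b ha hb => simp only [map_add, Finset.sum_add_distrib, ha, hb, add_zero]
  | tmul x y =>
    simp only [treeTensor, TensorProduct.map_tmul, TensorProduct.lift.tmul, LinearMap.comp_apply,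
      LinearMap.id_apply, ← LinearMap.sum_apply, ← map_sum]
    refine (congrArg (fun μ => ternaryTensor C M p q r φ ψ g μ y)
      (X.sum_composeAlong_eq_zero x)).trans ?_
    rw [map_zero, LinearMap.zero_apply]

/-- Equivariance of the coaction permutes the factors, equivariance of `M` permutes the values of
`φ` and `ψ`; what remains is the sign of exchanging `φ` with `ψ`. -/
theorem treeTensor_relabel [CharZero K] (hφ : φ ∈ DGModule.hom C.toDGModule A.toDGModule p)
    (hψ : ψ ∈ DGModule.hom C.toDGModule A.toDGModule q)
    (hg : g ∈ DGModule.hom C.toDGModule M.toDGModule r) (t : Tree 2) {n : ℤ} {c : C.toDGModule}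
    (hc : c ∈ C.gr n) :
    treeTensor C M p q r φ ψ g (t.relabel (Equiv.swap 0 1) 1)
        (evalTree X C.toDGModule (t.relabel (Equiv.swap 0 1) 1) (C.coact c)) =
      (-1 : K) ^ (p * q) •
        treeTensor C M q p r ψ φ g t (evalTree X C.toDGModule t (C.coact c)) := by
  rw [C.coact_perm 2 t (Equiv.swap 0 1) c, ← LinearMap.comp_apply, ← LinearMap.smul_apply]
  refine eq_of_mem_mixedGr (C.coact_mem 2 t n c hc) fun r' e s x he hx _ => ?_
  rw [LinearMap.comp_apply, TensorProduct.map_tmul, DGModule.koszul_tprod _ _ _ _ hx,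
    LinearMap.smul_apply, koszulSign_swap_three s, TensorProduct.tmul_smul, map_smul,
    treeTensor_tprod t (he 0) hx, LinearMap.id_apply, treeTensor_tprod _ (he 0)
      (s := fun i => s ((Equiv.swap 0 1 : Equiv.Perm (Fin 3)).symm i)) fun i => hx _]
  rw [← Generators.perm_tree]
  have h0 : (Equiv.swap 0 1 : Equiv.Perm (Fin 3)).symm 0 = 1 := by decide
  have h1 : (Equiv.swap 0 1 : Equiv.Perm (Fin 3)).symm 1 = 0 := by decide
  have h2 : (Equiv.swap 0 1 : Equiv.Perm (Fin 3)).symm 2 = 2 := by decide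
  rw [h0, h1, h2, M.ternary_perm _ (hφ _ _ (hx 1)) (hψ _ _ (hx 0)) (hg _ _ (hx 2))]
  simp only [smul_smul, ← neg_one_zpow_add]
  congr 1
  refine neg_one_zpow_congr ?_
  push_cast
  grind

end TreeTensor

/-! ## The Jacobi identity -/

section Jacobi

variable {X : QuadraticData.{u, v} K} {C : OpCoalgebra.{u, v, w} X}

/-- The tensors which arise from `e ⊗ x₀ ⊗ x₁` when a coproduct is inserted in place `i`. -/
def graftAt (i : Fin 2) (e : Fin 1 → X.E.susp.toDGModule) (x : Fin 2 → C.toDGModule) :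
    (⨂[K]^1 X.E.susp.toDGModule) ⊗[K] (⨂[K]^2 C.toDGModule) →ₗ[K]
      (⨂[K]^2 X.E.susp.toDGModule) ⊗[K] (⨂[K]^3 C.toDGModule) :=
  TensorProduct.map (TensorPower.mulEquiv (R := K) (n := 1) (m := 1)
      (M := X.E.susp.toDGModule)).toLinearMap LinearMap.id ∘ₗ
    (TensorProduct.assoc K (⨂[K]^1 X.E.susp.toDGModule) (⨂[K]^1 X.E.susp.toDGModule)
      (⨂[K]^3 C.toDGModule)).symm.toLinearMap ∘ₗ
    TensorProduct.mk K _ _ (PiTensorProduct.tprod K e) ∘ₗ insertAt (k := 1) 1 i x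

theorem graftAt_tprod [CharZero K] (i : Fin 2) {e e' : Fin 1 → X.E.susp.toDGModule}
    {x y : Fin 2 → C.toDGModule} {r : ℤ} (he' : e' 0 ∈ X.E.susp.gr r) {s : Fin 2 → ℤ}
    (hx : ∀ j, x j ∈ C.gr (s j)) :
    graftAt i e x (PiTensorProduct.tprod K e' ⊗ₜ[K] PiTensorProduct.tprod K y) =
      (-1 : K) ^ (r * ∑ j with j < i, s j) • (PiTensorProduct.tprod K ![e 0, e' 0] ⊗ₜ[K]
        PiTensorProduct.tprod K fun q : Fin 3 =>
          Sum.elim (fun j : {j : Fin 2 // j ≠ i} => x j.1) y ((placeEquiv 1 i).symm q)) := by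
  have he'' : ∀ j, e' j ∈ X.E.susp.gr r := fun j => by rwa [Fin.fin_one_eq_zero j]
  have h1 : Fin.append e e' = ![e 0, e' 0] := by
    funext q
    fin_cases q <;> rfl
  simp only [graftAt, LinearMap.comp_apply, insertAt_tprod i hx he'', map_smul]
  rw [Fin.sum_univ_one, TensorProduct.mk_apply, LinearEquiv.coe_coe,
    TensorProduct.assoc_symm_tmul, TensorProduct.map_tmul, LinearEquiv.coe_coe, mulEquiv_tprod, h1]
  rfl

theorem placeTuple_zero {V : Type v} (x y : Fin 2 → V) :
    (fun q : Fin 3 => Sum.elim (fun j : {j : Fin 2 // j ≠ 0} => x j.1) y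
      ((placeEquiv 1 0).symm q)) = ![y 0, y 1, x 1] := by
  -- The inverse of `placeEquiv` is obtained from bijectivity and does not reduce, so the comparison
  -- is made after pulling back along `placeEquiv`.
  have h (z : {j : Fin 2 // j ≠ 0} ⊕ Fin 2) : Sum.elim (fun j => x j.1) y z =
      ![y 0, y 1, x 1] (placeEquiv 1 0 z) := by
    rcases z with ⟨j, hj⟩ | j
    · fin_cases j
      exacts [(hj rfl).elim, rfl]
    · fin_cases j <;> rfl
  funext q
  rw [h, Equiv.apply_symm_apply]

theorem placeTuple_one {V : Type v} (x y : Fin 2 → V) :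
    (fun q : Fin 3 => Sum.elim (fun j : {j : Fin 2 // j ≠ 1} => x j.1) y
      ((placeEquiv 1 1).symm q)) = ![x 0, y 0, y 1] := by
  have h (z : {j : Fin 2 // j ≠ 1} ⊕ Fin 2) : Sum.elim (fun j => x j.1) y z =
      ![x 0, y 0, y 1] (placeEquiv 1 1 z) := by
    rcases z with ⟨j, hj⟩ | j
    · fin_cases j
      exacts [rfl, (hj rfl).elim]
    · fin_cases j <;> rfl
  funext q
  rw [h, Equiv.apply_symm_apply]

variable (C) in
/-- The coaction at a composite of two corollas, by coassociativity. -/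
theorem evalTree_graft {W : Type*} [AddCommGroup W] [Module K W]
    (F : (⨂[K]^2 X.E.susp.toDGModule) ⊗[K] (⨂[K]^3 C.toDGModule) →ₗ[K] W)
    (f : (⨂[K]^1 X.E.susp.toDGModule) ⊗[K] (⨂[K]^2 C.toDGModule) →ₗ[K] W)
    (i : Fin 2) {n : ℤ} {c : C.toDGModule} (hc : c ∈ C.gr n)
    (h : ∀ (r : ℤ) (e : Fin 1 → X.E.susp.toDGModule) (s : Fin 2 → ℤ) (x : Fin 2 → C.toDGModule),
      e 0 ∈ X.E.susp.gr r → (∀ i, x i ∈ C.gr (s i)) → r + (s 0 + s 1) = n →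
        f (PiTensorProduct.tprod K e ⊗ₜ[K] PiTensorProduct.tprod K x) =
          F (graftAt i e x (C.coprod (x i)))) :
    f (C.coprod c) =
      F (evalTree X C.toDGModule (k := 2) (Tree.corolla.graft i Tree.corolla) (C.coact c)) := by
  have h1 := congrArg F (C.coact_comp 1 1 i Tree.corolla Tree.corolla c)
  refine Eq.trans ?_ h1.symm
  refine eq_of_mem_mixedGr (f' := F ∘ₗ TensorProduct.map (TensorPower.mulEquiv (R := K)
    (n := 1) (m := 1) (M := X.E.susp.toDGModule)).toLinearMap LinearMap.id ∘ₗ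
    (TensorProduct.assoc K (⨂[K]^1 X.E.susp.toDGModule) (⨂[K]^1 X.E.susp.toDGModule)
      (⨂[K]^3 C.toDGModule)).symm.toLinearMap ∘ₗ
    TensorProduct.map LinearMap.id (applyAt X C.toDGModule (k := 1) 1 i C.coprod))
    (coprod_mem C hc) fun r e s x he hx hn => ?_
  rw [h (r 0) e s x (he 0) hx (by rw [← hn, Fin.sum_univ_one, Fin.sum_univ_two])]
  simp only [LinearMap.comp_apply, TensorProduct.map_tmul, applyAt_tprod]
  rfl

variable {A : OpAlgebra.{u, v, w'} X} {M : OpModule.{u, v, w', w''} A}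
  {p q r : ℤ} {φ ψ : C.toDGModule →ₗ[K] A.toDGModule} {g : C.toDGModule →ₗ[K] M.toDGModule}

/-- In `κ κ φ ψ g` the maps already stand in the right order. The factor `(-1)^((p+q+r) n)` moves
them from the right of the tensor to its left. The extra `-1` compares the sign `(-1)^|s μ|` of the
second `κ` passing the root decoration with the sign `(-1)^|μ|` used in `d₂`. -/
theorem kappaAction_kappaBracket [CharZero K] (hφ : φ ∈ DGModule.hom C.toDGModule A.toDGModule p)
    (hψ : ψ ∈ DGModule.hom C.toDGModule A.toDGModule q)
    (hg : g ∈ DGModule.hom C.toDGModule M.toDGModule r) {n : ℤ} {c : C.toDGModule}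
    (hc : c ∈ C.gr n) :
    kappaAction C M (p + q - 1) r (kappaBracket C A p q φ ψ) g c =
      (-1 : K) ^ ((p + q + r) * n + 1) • treeTensor C M p q r φ ψ g (Tree.comb 0)
        (evalTree X C.toDGModule (Tree.comb 0) (C.coact c)) := by
  rw [kappaAction_eq, LinearMap.comp_apply]
  refine evalTree_graft C ((-1 : K) ^ ((p + q + r) * n + 1) •
    treeTensor C M p q r φ ψ g (Tree.comb 0)) _ 0 hc fun r₁ e s x he hx hn => ?_
  rw [kappaTensor_tprod he (hx 0), kappaBracket_eq_kappaAction, kappaAction_eq]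
  -- The inner coproduct is that of `x 0`, so it too may be replaced by pure tensors, whose total
  -- degree is `s 0`.
  refine eq_of_mem_mixedGr (f := (-1 : K) ^ ((p + q - 1 + r) * r₁ + r * s 0) •
      ((M.binary (e 0)).flip (g (x 1)) ∘ₗ kappaTensor C A.selfModule p q φ ψ))
    (f' := ((-1 : K) ^ ((p + q + r) * n + 1) • treeTensor C M p q r φ ψ g (Tree.comb 0)) ∘ₗ
      graftAt 0 e x)
    (coprod_mem C (hx 0)) fun r₂ e' s' y he' hy hs' => ?_
  rw [Fin.sum_univ_one, Fin.sum_univ_two] at hs'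
  have hy' : ∀ j, ![y 0, y 1, x 1] j ∈ C.gr (![s' 0, s' 1, s 1] j) := by
    intro j
    fin_cases j
    exacts [hy 0, hy 1, hx 1]
  rw [LinearMap.smul_apply, LinearMap.comp_apply, LinearMap.flip_apply,
    kappaTensor_tprod (he' 0) (hy 0), LinearMap.comp_apply, graftAt_tprod 0 (he' 0) hx,
    placeTuple_zero]
  simp only [map_smul, LinearMap.smul_apply]
  rw [treeTensor_tprod _ (r₀ := r₁) he hy']
  erw [M.ternary_comb_zero (he' 0) (hφ _ _ (hy 0)) (hψ _ _ (hy 1)) (hg _ _ (hx 1))]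
  simp only [smul_smul, ← neg_one_zpow_add]
  refine congrArg (· • _) (neg_one_zpow_congr ?_)
  have h0 : ({j | j < 0} : Finset (Fin 2)) = ∅ := by decide
  rw [h0, Finset.sum_empty, ← hn, ← hs']
  simp only [Matrix.cons_val]
  push_cast
  grind

/-- Compared with the iterated bracket on the left, the inner `κ` has to pass `φ`; this is the
additional `p` in the exponent. -/
theorem kappaAction_kappaAction [CharZero K] (hφ : φ ∈ DGModule.hom C.toDGModule A.toDGModule p)
    (hψ : ψ ∈ DGModule.hom C.toDGModule A.toDGModule q)
    (hg : g ∈ DGModule.hom C.toDGModule M.toDGModule r) {n : ℤ} {c : C.toDGModule}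
    (hc : c ∈ C.gr n) :
    kappaAction C M p (q + r - 1) φ (kappaAction C M q r ψ g) c =
      (-1 : K) ^ ((p + q + r) * n + p + 1) • treeTensor C M p q r φ ψ g (Tree.comb 1)
        (evalTree X C.toDGModule (Tree.comb 1) (C.coact c)) := by
  rw [treeTensor_swapAt Tree.comb_one, kappaAction_eq, LinearMap.comp_apply]
  refine evalTree_graft C ((-1 : K) ^ ((p + q + r) * n + p + 1) •
    treeTensor C M p q r φ ψ g Tree.rightComb) _ 1 hc fun r₁ e s x he hx hn => ?_
  rw [kappaTensor_tprod he (hx 0), kappaAction_eq]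
  refine eq_of_mem_mixedGr (f := (-1 : K) ^ ((p + (q + r - 1)) * r₁ + (q + r - 1) * s 0) •
      (M.binary (e 0) (φ (x 0)) ∘ₗ kappaTensor C M q r ψ g))
    (f' := ((-1 : K) ^ ((p + q + r) * n + p + 1) •
      treeTensor C M p q r φ ψ g Tree.rightComb) ∘ₗ graftAt 1 e x)
    (coprod_mem C (hx 1)) fun r₂ e' s' y he' hy hs' => ?_
  rw [Fin.sum_univ_one, Fin.sum_univ_two] at hs'
  have hy' : ∀ j, ![x 0, y 0, y 1] j ∈ C.gr (![s 0, s' 0, s' 1] j) := by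
    intro j
    fin_cases j
    exacts [hx 0, hy 0, hy 1]
  rw [LinearMap.smul_apply, LinearMap.comp_apply,
    kappaTensor_tprod (he' 0) (hy 0), LinearMap.comp_apply, graftAt_tprod 1 (he' 0) hx,
    placeTuple_one]
  simp only [map_smul, LinearMap.smul_apply]
  rw [treeTensor_tprod _ (r₀ := r₁) he hy']
  erw [M.ternary_rightComb (he' 0) (hφ _ _ (hx 0)) (hψ _ _ (hy 0)) (hg _ _ (hy 1))]
  simp only [smul_smul, ← neg_one_zpow_add]
  refine congrArg (· • _) (neg_one_zpow_congr ?_)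
  have h0 : ({j | j < 1} : Finset (Fin 2)) = {0} := by decide
  rw [h0, Finset.sum_singleton, ← hn, ← hs']
  simp only [Matrix.cons_val]
  push_cast
  grind

/-- Up to one common sign, the three terms are the three summands of `sum_treeTensor_comb`. -/
theorem kappaAction_jacobi [CharZero K] (hφ : φ ∈ DGModule.hom C.toDGModule A.toDGModule p)
    (hψ : ψ ∈ DGModule.hom C.toDGModule A.toDGModule q)
    (hg : g ∈ DGModule.hom C.toDGModule M.toDGModule r) :
    kappaAction C M (p + q - 1) r (kappaBracket C A p q φ ψ) g +
      (-1 : K) ^ p • kappaAction C M p (q + r - 1) φ (kappaAction C M q r ψ g) +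
      (-1 : K) ^ (p * q + q) •
        kappaAction C M q (p + r - 1) ψ (kappaAction C M p r φ g) = 0 := by
  refine DGModule.linearMap_ext fun n c hc => ?_
  have h := sum_treeTensor_comb (M := M) (p := p) (q := q) (r := r) (φ := φ) (ψ := ψ) (g := g) c
  -- The third comb is rewritten as the second one with `φ` and `ψ` exchanged, at the cost of
  -- `(-1)^(p q)`.
  rw [Fin.sum_univ_three, treeTensor_swapAt Tree.comb_two, treeTensor_relabel hφ hψ hg _ hc] at h
  have h' := congrArg (((-1 : K) ^ ((p + q + r) * n + 1)) • ·) h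
  simp only [smul_add, smul_zero, smul_smul, ← neg_one_zpow_add] at h'
  simp only [LinearMap.add_apply, LinearMap.smul_apply, LinearMap.zero_apply,
    kappaAction_kappaBracket hφ hψ hg hc, kappaAction_kappaAction hφ hψ hg hc,
    kappaAction_kappaAction hψ hφ hg hc, smul_smul, ← neg_one_zpow_add]
  rw [← h']
  congr 1
  · congr 2
    refine neg_one_zpow_congr ?_
    push_cast
    grind
  · congr 1
    refine neg_one_zpow_congr ?_
    push_cast
    grind

end Jacobi

/-! ## The shifted bracket -/

section Shift

variable {X : QuadraticData.{u, v} K} {C : OpCoalgebra.{u, v, w} X} {A : OpAlgebra.{u, v, w'} X}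

theorem shiftedBracket_eq_shiftedAction (p q : ℤ) (φ ψ : C.toDGModule →ₗ[K] A.toDGModule) :
    shiftedBracket C A p q φ ψ = shiftedAction C A.selfModule p (q + 1) φ ψ := by
  rw [shiftedBracket, kappaBracket_eq_kappaAction, shiftedAction]

variable {M : OpModule.{u, v, w', w''} A} {p q r : ℤ} {φ ψ : C.toDGModule →ₗ[K] A.toDGModule}
  {g : C.toDGModule →ₗ[K] M.toDGModule}

theorem shiftedAction_mem (hφ : φ ∈ shiftedHom C.toDGModule A.toDGModule p)
    (hg : g ∈ DGModule.hom C.toDGModule M.toDGModule q) :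
    shiftedAction C M p q φ g ∈ DGModule.hom C.toDGModule M.toDGModule (p + q) := by
  refine Submodule.smul_mem _ _ ?_
  have h := kappaAction_mem hφ hg
  rwa [show p + 1 + q - 1 = p + q by ring] at h

theorem shiftedAction_jacobi [CharZero K] (hφ : φ ∈ shiftedHom C.toDGModule A.toDGModule p)
    (hψ : ψ ∈ shiftedHom C.toDGModule A.toDGModule q)
    (hg : g ∈ DGModule.hom C.toDGModule M.toDGModule r) :
    shiftedAction C M p (q + r) φ (shiftedAction C M q r ψ g) =
      shiftedAction C M (p + q) r (shiftedBracket C A p q φ ψ) g +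
        (-1 : K) ^ (p * q) • shiftedAction C M q (p + r) ψ (shiftedAction C M p r φ g) := by
  have h := kappaAction_jacobi hφ hψ hg
  rw [show p + 1 + (q + 1) - 1 = p + q + 1 by ring, show q + 1 + r - 1 = q + r by ring,
    show p + 1 + r - 1 = p + r by ring] at h
  simp only [shiftedAction, shiftedBracket, kappaAction_smul_left, kappaAction_smul_right,
    smul_smul, ← neg_one_zpow_add]
  -- The double bracket enters `{φ, ψ} · g` with the sign `(-1)^(p+q) (-1)^p = (-1)^q`, but enters
  -- `h` with coefficient 1.
  have h' := congrArg (((-1 : K) ^ q) • ·) h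
  simp only [smul_add, smul_zero, smul_smul, ← neg_one_zpow_add] at h'
  rw [← sub_eq_zero, ← neg_eq_zero, ← h']
  match_scalars <;> simp only [mul_one, neg_neg_one_zpow] <;>
    refine neg_one_zpow_congr ?_ <;> push_cast <;> grind

theorem homD_shiftedAction (hφ : φ ∈ shiftedHom C.toDGModule A.toDGModule p)
    (hg : g ∈ DGModule.hom C.toDGModule M.toDGModule q) :
    DGModule.homD C.toDGModule M.toDGModule (p + q) (shiftedAction C M p q φ g) =
      shiftedAction C M (p - 1) q (shiftedD C.toDGModule A.toDGModule p φ) g +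
        (-1 : K) ^ p • shiftedAction C M p (q - 1) φ
          (DGModule.homD C.toDGModule M.toDGModule q g) := by
  have h := kappaAction_homD hφ hg
  rw [show p + 1 + q - 1 = p + q by ring] at h
  rw [shiftedAction, DGModule.homD_smul, h, shiftedAction, shiftedAction, shiftedD,
    show p + 1 - 1 = p by ring, show p - 1 + 1 = p by ring]
  simp only [smul_sub, smul_neg, smul_smul, ← neg_one_zpow_add]
  match_scalars <;> simp only [mul_one, neg_neg_one_zpow] <;>
    refine neg_one_zpow_congr ?_ <;> push_cast <;> grind

theorem isDGLieModule_hom [CharZero K] (C : OpCoalgebra.{u, v, w} X)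
    (M : OpModule.{u, v, w', w''} A) :
    IsDGLieModule (shiftedHom C.toDGModule A.toDGModule) (shiftedD C.toDGModule A.toDGModule)
      (shiftedBracket C A) (DGModule.hom C.toDGModule M.toDGModule)
      (DGModule.homD C.toDGModule M.toDGModule) (shiftedAction C M) where
  d_mem _ _ := DGModule.homD_mem
  d_add q m _ n _ := DGModule.homD_add q m n
  d_smul q c n _ := DGModule.homD_smul q c n
  d_d q n _ := DGModule.homD_homD q n
  act_mem _ _ _ hx _ hn := shiftedAction_mem hx hn
  add_act _ _ _ _ _ _ _ _ := by
    rw [shiftedAction, kappaAction_add_left, smul_add]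
    rfl
  act_add _ _ _ _ _ _ _ _ := by
    rw [shiftedAction, kappaAction_add_right, smul_add]
    rfl
  smul_act _ _ _ _ _ _ _ := by
    rw [shiftedAction, kappaAction_smul_left, smul_comm]
    rfl
  act_smul _ _ _ _ _ _ _ := by
    rw [shiftedAction, kappaAction_smul_right, smul_comm]
    rfl
  jacobi _ _ _ _ hx _ hy _ hn := shiftedAction_jacobi hx hy hn
  leibniz _ _ _ hx _ hn := homD_shiftedAction hx hn

/-- The shift turns symmetry into antisymmetry: `p + (p+1)(q+1)` and `p q + q + 1` have the same
parity. -/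
theorem shiftedBracket_antisymm [CharZero K] (hφ : φ ∈ shiftedHom C.toDGModule A.toDGModule p)
    (hψ : ψ ∈ shiftedHom C.toDGModule A.toDGModule q) :
    shiftedBracket C A p q φ ψ = -((-1 : K) ^ (p * q) • shiftedBracket C A q p ψ φ) := by
  rw [shiftedBracket, kappaBracket_swap A hφ hψ, shiftedBracket]
  simp only [smul_smul, ← neg_one_zpow_add]
  rw [← neg_smul, neg_neg_one_zpow]
  refine congrArg (· • _) (neg_one_zpow_congr ?_)
  push_cast
  grind

/-- Since `L_q` is the component of degree `q + 1` of `Hom(C, A)`, the module axioms for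
`A.selfModule` are used with module degree `q + 1`. Only antisymmetry needs a separate argument. -/
theorem isDGLieAlgebra_hom [CharZero K] (C : OpCoalgebra.{u, v, w} X)
    (A : OpAlgebra.{u, v, w'} X) :
    IsDGLieAlgebra (shiftedHom C.toDGModule A.toDGModule) (shiftedD C.toDGModule A.toDGModule)
      (shiftedBracket C A) := by
  have h := isDGLieModule_hom C A.selfModule
  refine ⟨fun p x hx => ?_, fun p x hx y hy => h.d_add _ _ hx _ hy,
    fun p c x hx => h.d_smul _ c _ hx, fun p x hx => ?_, fun p q x hx y hy => ?_,
    fun p q x hx x' hx' y hy => ?_, fun p q x hx y hy y' hy' => ?_, fun p q c x hx y hy => ?_,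
    fun p q c x hx y hy => ?_, fun p q x hx y hy => shiftedBracket_antisymm hx hy,
    fun p q r x hx y hy z hz => ?_, fun p q x hx y hy => ?_⟩
  · have := h.d_mem (p + 1) x hx
    rwa [add_sub_right_comm] at this
  · have := h.d_d (p + 1) x hx
    rwa [add_sub_right_comm] at this
  · have := h.act_mem p (q + 1) x hx y hy
    rwa [← shiftedBracket_eq_shiftedAction, ← add_assoc] at this
  · simp only [shiftedBracket_eq_shiftedAction]
    exact h.add_act p (q + 1) x hx x' hx' y hy
  · simp only [shiftedBracket_eq_shiftedAction]
    exact h.act_add p (q + 1) x hx y hy y' hy'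
  · simp only [shiftedBracket_eq_shiftedAction]
    exact h.smul_act p (q + 1) c x hx y hy
  · simp only [shiftedBracket_eq_shiftedAction]
    exact h.act_smul p (q + 1) c x hx y hy
  · have := h.jacobi p q (r + 1) x hx y hy z hz
    rwa [← add_assoc, ← add_assoc, ← shiftedBracket_eq_shiftedAction,
      ← shiftedBracket_eq_shiftedAction, ← shiftedBracket_eq_shiftedAction,
      ← shiftedBracket_eq_shiftedAction, ← shiftedBracket_eq_shiftedAction] at this
  · have := h.leibniz p (q + 1) x hx y hy
    rwa [← add_assoc, add_sub_right_comm, ← shiftedBracket_eq_shiftedAction,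
      ← shiftedBracket_eq_shiftedAction, ← shiftedBracket_eq_shiftedAction] at this

end Shift

end

end OperadLie

theorem mainTheorem8 {K : Type u} [Field K] [CharZero K]
    (X : OperadLie.QuadraticData.{u, v} K) (A : OperadLie.OpAlgebra.{u, v, w} X)
    (C : OperadLie.OpCoalgebra.{u, v, w'} X) :
    OperadLie.IsDGLieAlgebra
        (OperadLie.shiftedHom C.toDGModule A.toDGModule)
        (OperadLie.shiftedD C.toDGModule A.toDGModule)
        (OperadLie.shiftedBracket C A) ∧
      ∀ M : OperadLie.OpModule.{u, v, w, w''} A,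
        OperadLie.IsDGLieModule
          (OperadLie.shiftedHom C.toDGModule A.toDGModule)
          (OperadLie.shiftedD C.toDGModule A.toDGModule)
          (OperadLie.shiftedBracket C A)
          (OperadLie.DGModule.hom C.toDGModule M.toDGModule)
          (OperadLie.DGModule.homD C.toDGModule M.toDGModule)
          (OperadLie.shiftedAction C M) := by
  exact ⟨OperadLie.isDGLieAlgebra_hom C A, OperadLie.isDGLieModule_hom C⟩
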